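/- \textbf{Definitions.} Let $K$ be a field, $R=K[x_1,\dots,x_n]$, and let $J$ be a monomial ideal of a polynomial ring over $K$. Let $G(J)$ be its minimal set of monomial generators. The \emph{incidence matrix} of $J$ has as columns the exponent vectors of the elements of $G(J)$. The \emph{signature} $\mathrm{sgn}(J)$ is the monomial ideal of the same ring obtained as follows: in each row of the incidence matrix, with distinct entries $m_0<m_1<\cdots<m_t$, replace every entry $m_k$ by $k$; then $\mathrm{sgn}(J)$ is generated by the monomials whose exponent vectors are the columns of the resulting matrix. $J$ has a \emph{gap} $(p,d)$ at a variable $x$ ($p\ge 0$, $d\ge 2$) if the exponents $0,1,\dots,p$ of $x$ all occur in $G(J)$ and the next larger exponent of $x$ that occurs in $G(J)$ is $p+d$. The corresponding \emph{weighted partial polarization} of $J$ is the ideal, in the polynomial ring with one new variable $z$, obtained from $G(J)$ by replacing $x^{q}u$ by $z\,x^{q-d}u$ for every generator $x^{q}u$ with $x\nmid u$ and $q\ge p+d$, and keeping the other generators; the corresponding \emph{shift} of $J$ is obtained from it by setting $z=x$, i.e. by replacing these $x^{q}u$ by $x^{q-d+1}u$. A \emph{weighted polarization} of a monomial ideal $I\subset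 R$ is an ideal of $R[z_1,\dots,z_r]$ obtained from $I$ by $r\ge 0$ successive weighted partial polarizations, the $i$-th one at a gap of width $d_i$ at a variable $x_{j_i}$ and with new variable $z_i$. It is \emph{full} if the corresponding sequence of shifts (the $i$-th one at the gap of width $d_i$ at $x_{j_i}$), started at $I$, ends at $\mathrm{sgn}(I)$. Depths of quotients of a polynomial ring are taken with respect to the ideal generated by all variables. \textbf{Proposition.} Let $I\subsetneq R=K[x_1,\dots,x_n]$ be a proper monomial ideal of height at least $2$. Then there are an integer $r\ge 0$, a polynomial ring $S=R[z_1,\dots,z_r]$, a full weighted polarization $I_{\mathrm{pol}}\subset S$ of $I$, given by variables $x_{j_1},\dots,x_{j_r}$ and widths $d_1,\dots,d_r$, such that, with $M=S/I_{\mathrm{pol}}$: \begin{enumerate} \item[(a)] $d_i\ge 2$ for all $i$, and $\underline f=\{z_i-x_{j_i}^{d_i}\}_{i=1}^r$ and $\underline g=\{z_i-x_{j_i}\}_{i=1}^r$ are $S$-regular sequences; \item[(b)] $\underline f$ and $\underline g$ are $M$-regular sequences; \item[(c)] $M/(\underline f)=R/I$ and $M/(\underline g)=R/\mathrm{sgn}(I)$,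 that is, the inclusion $R\subset S$ induces $K$-algebra isomorphisms $R/I\cong M/(\underline f)$ and $R/\mathrm{sgn}(I)\cong M/(\underline g)$; \item[(d)] $\mathrm{ht}(I)=\mathrm{ht}(I_{\mathrm{pol}})=\mathrm{ht}(\mathrm{sgn}(I))$; \item[(e)] $\dim M=\dim(R/I)+r$ and $\mathrm{depth}\,M=\mathrm{depth}(R/I)+r$. \end{enumerate} -/

import Mathlib

open MvPolynomial

noncomputable section

namespace MonomialSignature

variable {K : Type*} [Field K]

/-- A monomial ideal of a polynomial ring: an ideal generated by monomials. -/
def IsMonomialIdeal {σ : Type*} (I : Ideal (MvPolynomial σ K)) : Prop :=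
  ∃ s : Set (σ →₀ ℕ), I = Ideal.span ((fun a => monomial a (1 : K)) '' s)

/-- The exponent vectors of the minimal monomial generators `G(I)`: the monomials of `I` that
are minimal under divisibility. They are the columns of the incidence matrix of `I`. -/
def gens {σ : Type*} (I : Ideal (MvPolynomial σ K)) : Set (σ →₀ ℕ) :=
  {a | Minimal (fun b => monomial b (1 : K) ∈ I) a}

/-- The set of distinct entries of the row of the incidence matrix indexed by the variable `i`. -/
def row {σ : Type*} (I : Ideal (MvPolynomial σ K)) (i : σ) : Set ℕ :=
  {m | ∃ a ∈ gens I, a i = m}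

/-- The ideal generated by the monomials `x ^ φ a`, where `x ^ a` runs over `G(I)`. -/
def mapGens {σ τ : Type*} (I : Ideal (MvPolynomial σ K)) (φ : (σ →₀ ℕ) → (τ →₀ ℕ)) :
    Ideal (MvPolynomial τ K) :=
  Ideal.span ((fun a => monomial (φ a) (1 : K)) '' gens I)

/-- The column of the signature matrix that corresponds to the column `a`: if the distinct entries
of row `i` are `m₀ < m₁ < ⋯`, then `a i = mₖ` is replaced by `k`, its position, which
is the number of distinct entries of the row that are smaller than `a i`. -/
def sgnExp {σ : Type*} [Finite σ] (I : Ideal (MvPolynomial σ K)) (a : σ →₀ ℕ) : σ →₀ ℕ :=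
  Finsupp.equivFunOnFinite.symm fun i => {m | m ∈ row I i ∧ m < a i}.ncard

/-- The signature ideal of `I`. -/
def sgn {σ : Type*} [Finite σ] (I : Ideal (MvPolynomial σ K)) : Ideal (MvPolynomial σ K) :=
  mapGens I (sgnExp I)

/-- The first gap of `I` with respect to the variable `x i`: all the exponents `0, …, p` of `x i`
occur in `G(I)`, the next exponent that occurs is `q = p + d`, and `d ≥ 2`. -/
def HasGap {σ : Type*} (I : Ideal (MvPolynomial σ K)) (i : σ) (p d : ℕ) : Prop :=
  2 ≤ d ∧ (∀ m ≤ p, m ∈ row I i) ∧ p + d ∈ row I i ∧ ∀ m ∈ row I i, m ≤ p ∨ p + d ≤ m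

/-- The substitution of the new variable `x₀` for `x i ^ d` (once) in the monomials whose exponent
at `x i` is above the gap. The old variables are embedded in the new ones by `e`. -/
def polExp {σ τ : Type*} (e : σ → τ) (x₀ : τ) (i : σ) (p d : ℕ) (a : σ →₀ ℕ) : τ →₀ ℕ :=
  if a i ≤ p then a.mapDomain e
  else (a - Finsupp.single i d).mapDomain e + Finsupp.single x₀ 1

/-- The weighted partial polarization of `I` at the gap `(p, d)` of the variable `x i`. -/
def partialPol {σ τ : Type*} (e : σ → τ) (x₀ : τ) (I : Ideal (MvPolynomial σ K))
    (i : σ) (p d : ℕ) : Ideal (MvPolynomial τ K) :=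
  mapGens I (polExp e x₀ i p d)

/-- The effect of the shift on exponents: the polarization followed by `x₀ = x i`. -/
def shiftExp {σ : Type*} (i : σ) (p d : ℕ) (a : σ →₀ ℕ) : σ →₀ ℕ :=
  if a i ≤ p then a else a - Finsupp.single i (d - 1)

/-- The shift of `I` at the gap `(p, d)` of the variable `x i`. -/
def shift {σ : Type*} (I : Ideal (MvPolynomial σ K)) (i : σ) (p d : ℕ) :
    Ideal (MvPolynomial σ K) :=
  mapGens I (shiftExp i p d)

/-- `WeightedPolarization I r j d P L`: the ideal `P` of `K[x₁, …, xₙ][z₁, …, z_r]` is obtained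
from `I` by `r` successive weighted partial polarizations, where the `k`-th one substitutes the
new variable `z k` for `x (j k) ^ d k`, and the corresponding sequence of shifts leads from `I`
to `L`. The variables `x` are `Sum.inl`, the variables `z` are `Sum.inr`. Only the `x i` have to
be considered: the exponents of the `z k` are at most `1`, so that they never have a gap. -/
inductive WeightedPolarization {n : ℕ} (I : Ideal (MvPolynomial (Fin n) K)) :
    (r : ℕ) → (Fin r → Fin n) → (Fin r → ℕ) →
      Ideal (MvPolynomial (Fin n ⊕ Fin r) K) → Ideal (MvPolynomial (Fin n) K) → Prop
  | refl (j : Fin 0 → Fin n) (d : Fin 0 → ℕ) :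
      WeightedPolarization I 0 j d (I.map (rename (R := K) Sum.inl)) I
  | step {r : ℕ} {j : Fin r → Fin n} {d : Fin r → ℕ}
      {P : Ideal (MvPolynomial (Fin n ⊕ Fin r) K)} {L : Ideal (MvPolynomial (Fin n) K)}
      (i : Fin n) (p p' w : ℕ) (h : WeightedPolarization I r j d P L)
      (hP : HasGap P (Sum.inl i) p w) (hL : HasGap L i p' w) :
      WeightedPolarization I (r + 1) (Fin.snoc (α := fun _ => Fin n) j i)
        (Fin.snoc (α := fun _ => ℕ) d w)
        (partialPol (Sum.map id Fin.castSucc) (Sum.inr (Fin.last r)) P (Sum.inl i) p w)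
        (shift L i p' w)

/-- A weighted polarization is full if the corresponding sequence of shifts ends at the
signature of `I`. -/
def IsFullWeightedPolarization {n : ℕ} (I : Ideal (MvPolynomial (Fin n) K)) (r : ℕ)
    (j : Fin r → Fin n) (d : Fin r → ℕ) (P : Ideal (MvPolynomial (Fin n ⊕ Fin r) K)) : Prop :=
  WeightedPolarization I r j d P (sgn I)

/-- The depth of an `A`-module `M` with respect to an ideal `J`: the supremum of the lengths of the
`M`-regular sequences of elements of `J`. -/
def depth {A : Type*} [CommRing A] (J : Ideal A) (M : Type*) [AddCommGroup M] [Module A M] :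
    ℕ∞ :=
  ⨆ (rs : List A) (_ : (∀ a ∈ rs, a ∈ J) ∧ RingTheory.Sequence.IsRegular M rs), (rs.length : ℕ∞)

/-- The depth of the quotient of a polynomial ring by an ideal, with respect to the homogeneous
maximal ideal generated by the variables. -/
def quotDepth {σ : Type*} (I : Ideal (MvPolynomial σ K)) : ℕ∞ :=
  depth (Ideal.span (Set.range (X : σ → MvPolynomial σ K))) (MvPolynomial σ K ⧸ I)

/-- `M/(h) = R/L`, where `R = K[x₁, …, xₙ]`, `S = R[z₁, …, z_r]`, `M = S/P`: the inclusion of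
`R` in `S` induces an isomorphism of `R/L` with `M/(h)`. -/
def QuotientEq {n r : ℕ} (P : Ideal (MvPolynomial (Fin n ⊕ Fin r) K))
    (h : Fin r → MvPolynomial (Fin n ⊕ Fin r) K) (L : Ideal (MvPolynomial (Fin n) K)) : Prop :=
  ∃ e : (MvPolynomial (Fin n) K ⧸ L) ≃ₐ[K]
      ((MvPolynomial (Fin n ⊕ Fin r) K ⧸ P) ⧸
        Ideal.span (Set.range fun k => Ideal.Quotient.mk P (h k))),
    ∀ a, e (Ideal.Quotient.mk L a) =
      Ideal.Quotient.mk _ (Ideal.Quotient.mk P (rename Sum.inl a))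

end MonomialSignature

end

/-! A gap is recorded by its variable `j l`, its width `d l` and its upper end `t l` in the row of
the original ideal. After polarizing at a family of gaps, the generator coming from `a` contains
`z_l` exactly when `t l ≤ a (j l)`, and its exponent at `x_i` is `a i` minus the widths of the
recorded gaps that end at or below `a i`; this closed form is `polarizedExp`. Substituting `x_{j l}
^ d l` for `z_l` restores `a`. Substituting `x_{j l}` leaves one unit per gap, which is
`shiftedExp`; once all gaps are recorded, this is the position of `a i` in its row, so the shifts
end at the signature. Height at least 2 means that no variable divides all generators, so every row
starts at 0. Adding the lowest missing gap of a row is always a legal step, and finiteness of the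
rows ends the process (`exists_complete_of_isGapFamily`).

Both sequences have the form `z_l - x_{j l} ^ e l`, with `e = d` or `e = 1`. Modulo the first `k` of
them the ideal becomes monomial again, and `mem_of_X_sub_monomial_mul_mem` tests regularity of the
next one. The test succeeds for every `e` (`IsGapFamily.isWeaklyRegular`), because a generator
without `z_k` comes from a smaller exponent of `x_{j k}` than a generator with `z_k`, and
polarization preserves the weak order of these exponents.

Depth drops by exactly `r` along a regular sequence of length `r`. This rests on an exchange
argument with prime avoidance (`HasWeaklyRegularSeq.quotSMulTop`). Height and dimension are read off
from minimum vertex covers of the supports of the generators (`exists_isCover_height_eq`), and these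
have the same size for the ideal, its full polarization and its signature. -/

open MvPolynomial

noncomputable section

namespace MonomialSignature

variable {K : Type*} [Field K]

/-! ### Depth modulo a regular sequence. -/

section Depth

open RingTheory.Sequence Pointwise

/-- The ideal `J` contains a weakly `M`-regular sequence of length `n`. -/
def HasWeaklyRegularSeq {A : Type*} [CommRing A] (J : Ideal A) (M : Type*) [AddCommGroup M]
    [Module A M] (n : ℕ) : Prop :=
  ∃ rs : List A, rs.length = n ∧ (∀ a ∈ rs, a ∈ J) ∧ IsWeaklyRegular M rs

variable {A : Type*} [CommRing A] {J : Ideal A}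

theorem hasWeaklyRegularSeq_zero {M : Type*} [AddCommGroup M] [Module A M] :
    HasWeaklyRegularSeq J M 0 :=
  ⟨[], rfl, by simp, .nil A M⟩

theorem hasWeaklyRegularSeq_succ_iff {M : Type*} [AddCommGroup M] [Module A M] {n : ℕ} :
    HasWeaklyRegularSeq J M (n + 1) ↔
      ∃ x ∈ J, IsSMulRegular M x ∧ HasWeaklyRegularSeq J (QuotSMulTop x M) n := by
  constructor
  · rintro ⟨_ | ⟨x, rs⟩, hl, hJ, hreg⟩
    · simp at hl
    · rw [isWeaklyRegular_cons_iff] at hreg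
      exact ⟨x, hJ x (by simp), hreg.1, rs, by simpa using hl,
        fun a ha => hJ a (by simp [ha]), hreg.2⟩
  · rintro ⟨x, hx, hxr, rs, hl, hJ, hreg⟩
    exact ⟨x :: rs, by simp [hl], by simpa [hx] using hJ,
      (isWeaklyRegular_cons_iff M x rs).2 ⟨hxr, hreg⟩⟩

theorem HasWeaklyRegularSeq.congr {M N : Type*} [AddCommGroup M] [Module A M]
    [AddCommGroup N] [Module A N] {n : ℕ} (h : HasWeaklyRegularSeq J M n) (e : M ≃ₗ[A] N) :
    HasWeaklyRegularSeq J N n := by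
  obtain ⟨rs, hl, hJ, hreg⟩ := h
  exact ⟨rs, hl, hJ, (e.isWeaklyRegular_congr rs).1 hreg⟩

theorem HasWeaklyRegularSeq.mono {M : Type*} [AddCommGroup M] [Module A M] {m n : ℕ}
    (h : HasWeaklyRegularSeq J M n) (hmn : m ≤ n) : HasWeaklyRegularSeq J M m := by
  obtain ⟨rs, hl, hJ, hreg⟩ := h
  refine ⟨rs.take m, by simp [hl, hmn], fun a ha => hJ a (List.mem_of_mem_take ha), ?_⟩
  rw [← List.take_append_drop m rs, isWeaklyRegular_append_iff] at hreg
  exact hreg.1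

/-- Prime avoidance: an ideal which annihilates no nonzero element of a finite module over a
Noetherian ring contains an element that is regular on the module. -/
theorem exists_isSMulRegular_of_forall_smul_eq_zero [IsNoetherianRing A] {M : Type*}
    [AddCommGroup M] [Module A M] [Module.Finite A M]
    (h : ∀ u : M, (∀ a ∈ J, a • u = 0) → u = 0) : ∃ z ∈ J, IsSMulRegular M z := by
  by_contra! hcon
  have hsub : (J : Set A) ⊆ ⋃ p ∈ ((associatedPrimes.finite A M).toFinset : Set (Ideal A)), p := by
    intro a ha
    have := (biUnion_associatedPrimes_eq_compl_regular A M).ge (hcon a ha)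
    simpa using this
  obtain ⟨p, hp, hJp⟩ := (Ideal.subset_union_prime (f := id) ⊥ ⊥ (fun p hp _ _ =>
    ((associatedPrimes.finite A M).mem_toFinset.1 hp).isPrime)).1 hsub
  obtain ⟨hprime, u, hu⟩ := isAssociatedPrime_iff.1 ((associatedPrimes.finite A M).mem_toFinset.1 hp)
  have hu0 : u = 0 := by
    refine h u fun a ha => ?_
    have : a ∈ p := hJp ha
    rw [hu] at this
    simpa [Submodule.mem_colon_singleton] using this
  refine hprime.ne_top ?_
  rw [hu, hu0]
  simp

theorem isSMulRegular_of_annihilator {M : Type*} [AddCommGroup M] [Module A M] {z : A}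
    (hz : z ∈ J) (hreg : IsSMulRegular M z) (u : M) (hu : ∀ a ∈ J, a • u = 0) : u = 0 :=
  hreg.right_eq_zero_of_smul (hu z hz)

theorem mem_smul_top_iff_exists {M : Type*} [AddCommGroup M] [Module A M] {x : A} {m : M} :
    m ∈ (x • (⊤ : Submodule A M)) ↔ ∃ m', m = x • m' := by
  simp [Submodule.mem_smul_pointwise_iff_exists, eq_comm]

theorem isSMulRegular_quotSMulTop_iff {M : Type*} [AddCommGroup M] [Module A M] {x y : A} :
    IsSMulRegular (QuotSMulTop x M) y ↔
      ∀ m m' : M, y • m = x • m' → ∃ m'', m = x • m'' := by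
  refine (isSMulRegular_quotient_iff_mem_of_smul_mem _ _).trans ?_
  simp only [mem_smul_top_iff_exists, forall_exists_index]

/-- If `J` contains a regular element of `M/yM`, it annihilates no element of `M/xM`. -/
theorem eq_zero_of_smul_quotSMulTop {M : Type*} [AddCommGroup M] [Module A M] {x y w : A}
    (hx : IsSMulRegular M x) (hyJ : y ∈ J) (hy : IsSMulRegular M y)
    (hwJ : w ∈ J) (hw : IsSMulRegular (QuotSMulTop y M) w)
    (u : QuotSMulTop x M) (hu : ∀ a ∈ J, a • u = 0) : u = 0 := by
  obtain ⟨u, rfl⟩ := Submodule.Quotient.mk_surjective _ u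
  have key : ∀ a ∈ J, ∃ v, a • u = x • v := by
    intro a ha
    have := hu a ha
    rw [← Submodule.Quotient.mk_smul, Submodule.Quotient.mk_eq_zero] at this
    exact mem_smul_top_iff_exists.1 this
  obtain ⟨v, hv⟩ := key y hyJ
  obtain ⟨m, hm⟩ := key w hwJ
  -- Both sides become `w • y • u` after multiplication by `x`, which can be cancelled. Regularity
  -- of `w` modulo `y` then makes `v` a multiple of `y`.
  have h1 : w • v = y • m := by
    apply hx
    change x • w • v = x • y • m
    rw [smul_comm x w v, smul_comm x y m, ← hv, ← hm, smul_comm]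
  obtain ⟨v', hv'⟩ := isSMulRegular_quotSMulTop_iff.1 hw v m h1
  rw [Submodule.Quotient.mk_eq_zero, mem_smul_top_iff_exists]
  refine ⟨v', hy ?_⟩
  change y • u = y • x • v'
  rw [hv, hv', smul_comm]

/-- From `y • m = z • m'`, regularity of `z` modulo `y` gives `m' = y • m''`, and `y` cancels. This
half of the permutability of regular sequences needs no local or finiteness hypothesis. -/
theorem isSMulRegular_quotSMulTop_swap {M : Type*} [AddCommGroup M] [Module A M] {y z : A}
    (hy : IsSMulRegular M y) (hz : IsSMulRegular (QuotSMulTop y M) z) :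
    IsSMulRegular (QuotSMulTop z M) y := by
  rw [isSMulRegular_quotSMulTop_iff] at hz ⊢
  intro m m' h
  obtain ⟨m'', hm''⟩ := hz m' m h.symm
  refine ⟨m'', hy ?_⟩
  change y • m = y • z • m''
  rw [h, hm'', smul_comm]

/-- The quotients by `x` and by `y` commute. -/
def quotSMulTopComm (M : Type*) [AddCommGroup M] [Module A M] (x y : A) :
    QuotSMulTop x (QuotSMulTop y M) ≃ₗ[A] QuotSMulTop y (QuotSMulTop x M) :=
  (QuotSMulTop.congr x (Submodule.quotEquivOfEq _ _ (by
      rw [Ideal.ofList_singleton, Submodule.ideal_span_singleton_smul])) ≪≫ₗ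
    (Submodule.quotOfListConsSMulTopEquivQuotSMulTopOuter M x [y]).symm) ≪≫ₗ
  (Submodule.quotOfListConsSMulTopEquivQuotSMulTopInner M x [y] ≪≫ₗ
    Submodule.quotEquivOfEq _ _ (by
      rw [Ideal.ofList_singleton, Submodule.ideal_span_singleton_smul]))

/-- An exchange argument: the given sequence starts with some `y`, not with `x`. An element `z`
regular on both `M/xM` and `M/yM` links the two: induction passes from `M/yM` to `M/(y,z)M`, hence a
sequence exists on `M/zM`, and induction again passes to `M/(z,x)M`, to which `z` is prepended. -/
theorem HasWeaklyRegularSeq.quotSMulTop [IsNoetherianRing A] {n : ℕ} :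
    ∀ {M : Type*} [AddCommGroup M] [Module A M] [Module.Finite A M] {x : A},
      HasWeaklyRegularSeq J M (n + 1) → x ∈ J → IsSMulRegular M x →
      HasWeaklyRegularSeq J (QuotSMulTop x M) n := by
  induction n with
  | zero => intros; exact hasWeaklyRegularSeq_zero
  | succ n ih =>
    intro M _ _ _ x h hxJ hx
    obtain ⟨y, hyJ, hy, hyn⟩ := hasWeaklyRegularSeq_succ_iff.1 h
    obtain ⟨w, hwJ, hw, -⟩ := hasWeaklyRegularSeq_succ_iff.1 hyn
    -- Prime avoidance on the product yields one element regular on both factors.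
    obtain ⟨z, hzJ, hz⟩ := exists_isSMulRegular_of_forall_smul_eq_zero (J := J)
      (M := QuotSMulTop x M × QuotSMulTop y M) (by
        rintro ⟨u, v⟩ huv
        refine Prod.ext ?_ ?_
        · exact eq_zero_of_smul_quotSMulTop hx hyJ hy hwJ hw u
            fun a ha => congrArg Prod.fst (huv a ha)
        · exact isSMulRegular_of_annihilator hwJ hw v fun a ha => congrArg Prod.snd (huv a ha))
    have hzx : IsSMulRegular (QuotSMulTop x M) z :=
      hz.of_injective (LinearMap.inl A _ _) LinearMap.inl_injective
    have hzy : IsSMulRegular (QuotSMulTop y M) z :=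
      hz.of_injective (LinearMap.inr A _ _) LinearMap.inr_injective
    have h1 : HasWeaklyRegularSeq J (QuotSMulTop y (QuotSMulTop z M)) n :=
      (ih hyn hzJ hzy).congr (quotSMulTopComm M z y)
    have h2 : HasWeaklyRegularSeq J (QuotSMulTop z M) (n + 1) :=
      hasWeaklyRegularSeq_succ_iff.2 ⟨y, hyJ, isSMulRegular_quotSMulTop_swap hy hzy, h1⟩
    have h3 := ih h2 hxJ (isSMulRegular_quotSMulTop_swap hx hzx)
    exact hasWeaklyRegularSeq_succ_iff.2 ⟨z, hzJ, hzx, h3.congr (quotSMulTopComm M x z)⟩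

theorem hasWeaklyRegularSeq_add_length_iff [IsNoetherianRing A] {n : ℕ} (rs : List A) :
    ∀ {M : Type*} [AddCommGroup M] [Module A M] [Module.Finite A M],
      (∀ a ∈ rs, a ∈ J) → IsWeaklyRegular M rs →
      (HasWeaklyRegularSeq J M (n + rs.length) ↔
        HasWeaklyRegularSeq J (M ⧸ (Ideal.ofList rs • ⊤ : Submodule A M)) n) := by
  induction rs with
  | nil =>
    intro M _ _ _ _ _
    have h0 : (Ideal.ofList ([] : List A) • ⊤ : Submodule A M) = ⊥ := by
      rw [Ideal.ofList_nil]
      exact Submodule.bot_smul _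
    have e : M ≃ₗ[A] (M ⧸ (Ideal.ofList ([] : List A) • ⊤ : Submodule A M)) :=
      (Submodule.quotEquivOfEqBot _ h0).symm
    exact ⟨fun h => h.congr e, fun h => h.congr e.symm⟩
  | cons x rs ih =>
    intro M _ _ _ hJ hreg
    rw [isWeaklyRegular_cons_iff] at hreg
    have hxJ : x ∈ J := hJ x (by simp)
    have e := Submodule.quotOfListConsSMulTopEquivQuotSMulTopInner M x rs
    have h1 : HasWeaklyRegularSeq J M (n + (x :: rs).length) ↔
        HasWeaklyRegularSeq J (QuotSMulTop x M) (n + rs.length) := by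
      rw [List.length_cons, ← add_assoc]
      exact ⟨fun h => h.quotSMulTop hxJ hreg.1,
        fun h => hasWeaklyRegularSeq_succ_iff.2 ⟨x, hxJ, hreg.1, h⟩⟩
    rw [h1, ih (fun a ha => hJ a (by simp [ha])) hreg.2]
    exact ⟨fun h => h.congr e.symm, fun h => h.congr e⟩

theorem isRegular_of_isWeaklyRegular_of_smul_top_ne {M : Type*} [AddCommGroup M] [Module A M]
    (hM : J • (⊤ : Submodule A M) ≠ ⊤) {rs : List A} (hJ : ∀ a ∈ rs, a ∈ J)
    (h : IsWeaklyRegular M rs) : IsRegular M rs where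
  toIsWeaklyRegular := h
  top_ne_smul heq := hM <| top_le_iff.1 <| heq.le.trans <|
    Submodule.smul_mono_left (Ideal.span_le.2 hJ)

/-- Since `J M ≠ M`, weakly regular sequences in `J` are regular, and truncation produces every
smaller length. -/
theorem natCast_le_depth_iff {M : Type*} [AddCommGroup M] [Module A M]
    (hM : J • (⊤ : Submodule A M) ≠ ⊤) {n : ℕ} :
    (n : ℕ∞) ≤ depth J M ↔ HasWeaklyRegularSeq J M n := by
  constructor
  · intro h
    rcases n with _ | n
    · exact hasWeaklyRegularSeq_zero
    -- A strict bound is needed to extract an actual sequence from the supremum.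
    have h' : (n : ℕ∞) < depth J M :=
      lt_of_lt_of_le (by exact_mod_cast n.lt_succ_self) h
    simp only [depth, lt_iSup_iff, Nat.cast_lt] at h'
    obtain ⟨rs, hrs, hlt⟩ := h'
    exact HasWeaklyRegularSeq.mono ⟨rs, rfl, hrs.1, hrs.2.1⟩ hlt
  · rintro ⟨rs, rfl, hJ, hreg⟩
    exact le_iSup₂_of_le rs ⟨hJ, isRegular_of_isWeaklyRegular_of_smul_top_ne hM hJ hreg⟩ le_rfl

theorem depth_eq_add_of_hasWeaklyRegularSeq_iff {B M N : Type*} [CommRing B] {J' : Ideal B}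
    [AddCommGroup M] [Module A M] [AddCommGroup N] [Module B N]
    (hM : J • (⊤ : Submodule A M) ≠ ⊤) (hN : J' • (⊤ : Submodule B N) ≠ ⊤) (r : ℕ)
    (hr : HasWeaklyRegularSeq J M r)
    (h : ∀ n, HasWeaklyRegularSeq J M (n + r) ↔ HasWeaklyRegularSeq J' N n) :
    depth J M = depth J' N + r := by
  refine ENat.eq_of_forall_natCast_le_iff fun m => ?_
  rw [natCast_le_depth_iff hM]
  rcases le_total m r with hmr | hmr
  · exact iff_of_true (hr.mono hmr) ((Nat.cast_le.2 hmr).trans le_add_self)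
  · obtain ⟨n, rfl⟩ := Nat.exists_eq_add_of_le' hmr
    rw [h, ← natCast_le_depth_iff hN, Nat.cast_add]
    exact (ENat.add_le_add_iff_right (ENat.natCast_ne_top r)).symm

end Depth

/-! ### Monomial ideals and their minimal generators. -/

section MonomialSpan

variable {σ : Type*}

variable (K) in
/-- The ideal generated by the monomials with exponents in `A`. -/
abbrev monomialSpan (A : Set (σ →₀ ℕ)) : Ideal (MvPolynomial σ K) :=
  Ideal.span ((fun a => monomial a (1 : K)) '' A)

theorem monomial_mem_monomialSpan_iff {A : Set (σ →₀ ℕ)} {b : σ →₀ ℕ} :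
    monomial b (1 : K) ∈ monomialSpan K A ↔ ∃ a ∈ A, a ≤ b := by
  classical
  rw [mem_ideal_span_monomial_image, support_monomial, if_neg one_ne_zero]
  simp

theorem gens_monomialSpan {A : Set (σ →₀ ℕ)} (hA : ∀ a ∈ A, ∀ b ∈ A, a ≤ b → a = b) :
    gens (monomialSpan K A) = A := by
  ext a
  simp only [gens, Set.mem_ofPred_eq, monomial_mem_monomialSpan_iff]
  constructor
  · rintro ⟨⟨b, hb, hba⟩, hmin⟩
    rwa [(hmin ⟨b, hb, le_rfl⟩ hba).antisymm hba]
  · refine fun ha => ⟨⟨a, ha, le_rfl⟩, ?_⟩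
    rintro b ⟨c, hc, hcb⟩ hba
    exact (hA c hc a ha (hcb.trans hba)) ▸ hcb

theorem eq_of_le_of_mem_gens {I : Ideal (MvPolynomial σ K)} {a b : σ →₀ ℕ} (ha : a ∈ gens I)
    (hb : b ∈ gens I) (h : a ≤ b) : a = b :=
  h.antisymm (hb.2 ha.1 h)

theorem mapGens_eq_monomialSpan {τ : Type*} {I : Ideal (MvPolynomial σ K)}
    {φ : (σ →₀ ℕ) → (τ →₀ ℕ)} : mapGens I φ = monomialSpan K (φ '' gens I) := by
  rw [mapGens, monomialSpan, Set.image_image]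

/-- A map that reflects divisibility sends the antichain of generators to an antichain, so no image
becomes redundant. This is what allows successive polarizations and shifts to be composed on
exponents. -/
theorem gens_mapGens {τ : Type*} {I : Ideal (MvPolynomial σ K)} {φ : (σ →₀ ℕ) → (τ →₀ ℕ)}
    (hφ : ∀ a ∈ gens I, ∀ b ∈ gens I, φ a ≤ φ b → a ≤ b) :
    gens (mapGens I φ) = φ '' gens I := by
  rw [mapGens_eq_monomialSpan]
  refine gens_monomialSpan ?_
  rintro _ ⟨a, ha, rfl⟩ _ ⟨b, hb, rfl⟩ hab
  rw [eq_of_le_of_mem_gens ha hb (hφ a ha b hb hab)]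

theorem mapGens_mapGens {τ υ : Type*} {I : Ideal (MvPolynomial σ K)}
    {φ : (σ →₀ ℕ) → (τ →₀ ℕ)} {ψ : (τ →₀ ℕ) → (υ →₀ ℕ)}
    (hφ : ∀ a ∈ gens I, ∀ b ∈ gens I, φ a ≤ φ b → a ≤ b) :
    mapGens (mapGens I φ) ψ = mapGens I (ψ ∘ φ) := by
  rw [mapGens_eq_monomialSpan, gens_mapGens hφ, Set.image_image, mapGens_eq_monomialSpan]
  rfl

theorem mapGens_congr {τ : Type*} {I : Ideal (MvPolynomial σ K)}
    {φ ψ : (σ →₀ ℕ) → (τ →₀ ℕ)} (h : ∀ a ∈ gens I, φ a = ψ a) : mapGens I φ = mapGens I ψ := by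
  rw [mapGens_eq_monomialSpan, mapGens_eq_monomialSpan, Set.image_congr h]

theorem exists_mem_gens_le [Finite σ] {I : Ideal (MvPolynomial σ K)} {b : σ →₀ ℕ}
    (hb : monomial b (1 : K) ∈ I) : ∃ a ∈ gens I, a ≤ b := by
  obtain ⟨a, hab, ha⟩ := exists_minimal_le_of_wellFoundedLT
    (fun b => monomial b (1 : K) ∈ I) b hb
  exact ⟨a, ha, hab⟩

theorem IsMonomialIdeal.eq_monomialSpan_gens [Finite σ] {I : Ideal (MvPolynomial σ K)}
    (hI : IsMonomialIdeal I) : I = monomialSpan K (gens I) := by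
  apply le_antisymm
  · obtain ⟨s, hs⟩ := hI
    conv_lhs => rw [hs]
    rw [Ideal.span_le]
    rintro _ ⟨a, ha, rfl⟩
    refine monomial_mem_monomialSpan_iff.2 (exists_mem_gens_le ?_)
    rw [hs]
    exact Ideal.subset_span ⟨a, ha, rfl⟩
  · rw [Ideal.span_le]
    rintro _ ⟨a, ha, rfl⟩
    exact ha.1

/-- Dickson's lemma: antichains of exponent vectors are finite. -/
theorem finite_gens [Finite σ] (I : Ideal (MvPolynomial σ K)) : (gens I).Finite :=
  (setOfPred_minimal_antichain _).finite_of_partiallyWellOrderedOn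
    (Set.isPWO_of_wellQuasiOrderedLE _)

theorem finite_row [Finite σ] (I : Ideal (MvPolynomial σ K)) (i : σ) : (row I i).Finite :=
  ((finite_gens I).image fun a => a i).subset (by rintro _ ⟨a, ha, rfl⟩; exact ⟨a, ha, rfl⟩)

/-- Modulo `P`, `θ` and the identity are algebra maps that agree on the variables. -/
theorem sub_algHom_mem {P : Ideal (MvPolynomial σ K)}
    (θ : MvPolynomial σ K →ₐ[K] MvPolynomial σ K) (h : ∀ i, X i - θ (X i) ∈ P)
    (p : MvPolynomial σ K) : p - θ p ∈ P := by
  have : Ideal.Quotient.mkₐ K P = (Ideal.Quotient.mkₐ K P).comp θ := by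
    ext i
    exact Ideal.Quotient.eq.2 (h i)
  exact Ideal.Quotient.eq.1 (DFunLike.congr_fun this p)

end MonomialSpan

/-! ### Height and dimension from vertex covers. -/

section Cover

variable {σ : Type*}

/-- `C` is a vertex cover of the supports of the elements of `A`. -/
def IsCover (A : Set (σ →₀ ℕ)) (C : Finset σ) : Prop :=
  ∀ a ∈ A, ∃ i ∈ C, a i ≠ 0

variable (K) in
/-- The homomorphism which sets the variables in `C` equal to zero. -/
def killVars (C : Set σ) : MvPolynomial σ K →ₐ[K] MvPolynomial {i // i ∉ C} K :=
  open Classical in aeval fun i => if h : i ∈ C then 0 else X ⟨i, h⟩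

theorem killVars_surjective (C : Set σ) : Function.Surjective (killVars K C) := by
  have : (killVars K C).comp (rename Subtype.val) = AlgHom.id K _ := by
    ext i
    simp [killVars, i.2]
  exact fun p => ⟨rename Subtype.val p, DFunLike.congr_fun this p⟩

theorem ker_killVars (C : Set σ) :
    RingHom.ker (killVars K C) = Ideal.span (X '' C : Set (MvPolynomial σ K)) := by
  apply le_antisymm
  · intro p hp
    have := sub_algHom_mem (P := Ideal.span (X '' C : Set (MvPolynomial σ K)))
      ((rename Subtype.val).comp (killVars K C)) (fun i => ?_) p
    · rw [RingHom.mem_ker] at hp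
      rwa [AlgHom.comp_apply, hp, map_zero, sub_zero] at this
    · by_cases h : i ∈ C
      · simpa [killVars, h] using Ideal.subset_span (Set.mem_image_of_mem X h)
      · simp [killVars, h]
  · rw [Ideal.span_le]
    rintro _ ⟨i, hi, rfl⟩
    simp [RingHom.mem_ker, killVars, hi]

instance isPrime_span_X_image (C : Set σ) :
    (Ideal.span (X '' C : Set (MvPolynomial σ K))).IsPrime :=
  ker_killVars (K := K) C ▸ RingHom.ker_isPrime _

theorem X_mem_span_X_image_iff {C : Set σ} {i : σ} :
    (X i : MvPolynomial σ K) ∈ Ideal.span (X '' C : Set (MvPolynomial σ K)) ↔ i ∈ C := by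
  classical
  rw [mem_ideal_span_X_image, support_X]
  simp [Finsupp.single_apply]

/-- Adjoining the variables one at a time gives a strict chain of primes. -/
theorem card_le_height_span_X_image (C : Finset σ) :
    (C.card : ℕ∞) ≤ (Ideal.span (X '' (C : Set σ) : Set (MvPolynomial σ K))).height := by
  classical
  induction C using Finset.induction_on with
  | empty => simp
  | insert i C hi ih =>
    rw [Finset.card_insert_of_notMem hi, Nat.cast_add, Nat.cast_one]
    refine (add_le_add_left ih 1).trans (Ideal.height_add_one_le_of_lt_of_isPrime ?_)
    refine lt_of_le_of_ne (Ideal.span_mono (Set.image_mono (by simp))) fun h => hi ?_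
    have : (X i : MvPolynomial σ K) ∈
        Ideal.span (X '' ((insert i C : Finset σ) : Set σ) : Set (MvPolynomial σ K)) :=
      X_mem_span_X_image_iff.2 (by simp)
    rw [← h] at this
    simpa using X_mem_span_X_image_iff.1 this

theorem ringKrullDim_quotient_span_X_image [Finite σ] (C : Finset σ) :
    ringKrullDim (MvPolynomial σ K ⧸ Ideal.span (X '' (C : Set σ) : Set (MvPolynomial σ K))) +
      C.card = Nat.card σ := by
  classical
  have := Fintype.ofFinite σ
  rw [ringKrullDim_eq_of_ringEquiv ((Ideal.quotEquivOfEq (ker_killVars (C : Set σ)).symm).trans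
      (RingHom.quotientKerEquivOfSurjective (f := (killVars K (C : Set σ)).toRingHom)
        (killVars_surjective _))),
    MvPolynomial.ringKrullDim_of_isNoetherianRing, ringKrullDim_eq_zero_of_field, zero_add]
  have h1 : Nat.card {i // i ∉ (C : Set σ)} + C.card = Nat.card σ := by
    rw [Nat.card_eq_fintype_card, Nat.card_eq_fintype_card, Fintype.card_subtype_compl]
    simp [Nat.sub_add_cancel (Finset.card_le_univ C)]
  exact_mod_cast h1

/-- A chain of primes above `N` has its bottom prime of height at least `c`; height plus coheight of
that prime is at most the dimension. -/
theorem ringKrullDim_quotient_add_le {R : Type*} [CommRing R] (N : Ideal R) {c : ℕ}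
    (hc : (c : ℕ∞) ≤ N.height) : ringKrullDim (R ⧸ N) + c ≤ ringKrullDim R := by
  rw [ringKrullDim_quotient]
  rcases isEmpty_or_nonempty (PrimeSpectrum.zeroLocus (N : Set R)) with he | hne
  · rw [Order.krullDim_eq_bot, WithBot.bot_add]
    exact bot_le
  have : Nonempty (PrimeSpectrum R) := hne.map Subtype.val
  rw [Order.krullDim_eq_iSup_length, ringKrullDim,
    Order.krullDim_eq_iSup_height_add_coheight_of_nonempty]
  change ((_ + (c : ℕ∞) : ℕ∞) : WithBot ℕ∞) ≤ _
  rw [WithBot.coe_le_coe, ENat.iSup_add]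
  refine iSup_le fun l => le_iSup_of_le l.head.1 ?_
  rw [add_comm]
  refine add_le_add ?_ ?_
  · rw [← PrimeSpectrum.height_eq_orderHeight]
    exact hc.trans (Ideal.height_mono l.head.2)
  · exact Order.length_le_coheight_head (p := l.map Subtype.val fun _ _ h => h)

theorem IsCover.monomialSpan_le {A : Set (σ →₀ ℕ)} {C : Finset σ} (hC : IsCover A C) :
    monomialSpan K A ≤ Ideal.span (X '' (C : Set σ) : Set (MvPolynomial σ K)) := by
  classical
  rw [Ideal.span_le]
  rintro _ ⟨a, ha, rfl⟩
  obtain ⟨i, hi, hai⟩ := hC a ha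
  refine mem_ideal_span_X_image.2 fun m hm => ⟨i, hi, ?_⟩
  rw [support_monomial, if_neg one_ne_zero, Finset.mem_singleton] at hm
  rwa [hm]

theorem IsCover.height_le [Finite σ] {A : Set (σ →₀ ℕ)} {C : Finset σ} (hC : IsCover A C) :
    (monomialSpan K A).height ≤ C.card := by
  classical
  refine (Ideal.height_mono hC.monomialSpan_le).trans ?_
  refine Ideal.height_le_card_of_mem_minimalPrimes_span_finset (s := C.image X) ?_ |>.trans ?_
  · rw [Finset.coe_image, Ideal.minimalPrimes_eq_subsingleton_self]
    rfl
  · exact_mod_cast Finset.card_image_le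

/-- The variables in a minimal prime form a cover, since the prime contains a factor of every
generating monomial; the prime contains the ideal of this cover. -/
theorem le_height_monomialSpan [Finite σ] {A : Set (σ →₀ ℕ)} {c : ℕ}
    (hc : ∀ C, IsCover A C → c ≤ C.card) : (c : ℕ∞) ≤ (monomialSpan K A).height := by
  classical
  have := Fintype.ofFinite σ
  rw [Ideal.height_eq_inf_minimalPrimes]
  refine le_iInf₂ fun Q hQ => ?_
  have hQp : Q.IsPrime := hQ.1.1
  set C : Finset σ := Finset.univ.filter fun i => (X i : MvPolynomial σ K) ∈ Q with hC
  have hcov : IsCover A C := by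
    intro a ha
    have hm : monomial a (1 : K) ∈ Q := hQ.1.2 (Ideal.subset_span ⟨a, ha, rfl⟩)
    rw [monomial_eq, map_one, one_mul, Finsupp.prod, hQp.prod_mem_iff] at hm
    obtain ⟨i, hi, hiQ⟩ := hm
    exact ⟨i, by simpa [hC] using hQp.mem_of_pow_mem _ hiQ, by simpa using hi⟩
  refine (Nat.cast_le.2 (hc C hcov)).trans ((card_le_height_span_X_image (K := K) C).trans
    (Ideal.height_mono ?_))
  rw [Ideal.span_le]
  rintro _ ⟨i, hi, rfl⟩
  simpa [hC] using hi

/-- The height of a monomial ideal and the dimension of its quotient ring are determined by a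
minimum vertex cover. -/
theorem exists_isCover_height_eq [Finite σ] {A : Set (σ →₀ ℕ)} (hA : 0 ∉ A) :
    ∃ C : Finset σ, IsCover A C ∧ (∀ C', IsCover A C' → C.card ≤ C'.card) ∧
      (monomialSpan K A).height = C.card ∧
      ringKrullDim (MvPolynomial σ K ⧸ monomialSpan K A) + C.card = Nat.card σ := by
  have := Fintype.ofFinite σ
  have hne : ∃ C, IsCover A C := by
    refine ⟨Finset.univ, fun a ha => ?_⟩
    by_contra! h
    exact hA (by rwa [show a = 0 from Finsupp.ext fun i => h i (Finset.mem_univ i)] at ha)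
  obtain ⟨C, hC, hmin⟩ : ∃ C, IsCover A C ∧ ∀ C', IsCover A C' → C.card ≤ C'.card := by
    obtain ⟨C, hC⟩ := exists_minimalFor_of_wellFoundedLT (IsCover A) Finset.card hne
    exact ⟨C, hC.1, fun C' hC' => (le_total C.card C'.card).elim id (hC.2 hC')⟩
  have hle := le_height_monomialSpan (K := K) hmin
  -- The upper bound on the dimension comes from the height; the lower bound from the quotient by
  -- the variables in `C`, a polynomial ring in the others.
  refine ⟨C, hC, hmin, hC.height_le.antisymm hle, le_antisymm ?_ ?_⟩
  · refine (ringKrullDim_quotient_add_le _ hle).trans ?_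
    rw [MvPolynomial.ringKrullDim_of_isNoetherianRing, ringKrullDim_eq_zero_of_field, zero_add]
  · rw [← ringKrullDim_quotient_span_X_image (K := K) C]
    gcongr
    exact ringKrullDim_le_of_surjective (Ideal.Quotient.factor hC.monomialSpan_le)
      (Ideal.Quotient.factor_surjective _)

end Cover

/-! ### Regularity of `z - w` modulo a monomial ideal, and monomial substitutions. -/

section NonZeroDivisor

variable {σ : Type*}

/-- A criterion for `z - w`, where `z` is a variable and `w` is a monomial without `z`, to be
regular modulo the monomial ideal generated by `A`. -/
theorem mem_of_X_sub_monomial_mul_mem {A : Set (σ →₀ ℕ)} {z : σ} {w : σ →₀ ℕ} (hw : w z = 0)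
    (h1 : ∀ m : σ →₀ ℕ, m z ≠ 0 → (∃ a ∈ A, a ≤ m + Finsupp.single z 1) → ∃ a ∈ A, a ≤ m)
    (h2 : ∀ m : σ →₀ ℕ, (∃ a ∈ A, a ≤ m + Finsupp.single z 1) → (∃ a ∈ A, a ≤ m + w) →
      ∃ a ∈ A, a ≤ m)
    {h : MvPolynomial σ K} (hh : (X z - monomial w 1) * h ∈ monomialSpan K A) :
    h ∈ monomialSpan K A := by
  classical
  rw [mem_ideal_span_monomial_image] at hh ⊢
  by_contra hcon
  set T := h.support.filter fun m => ¬ ∃ a ∈ A, a ≤ m with hT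
  have hTne : T.Nonempty := by
    push Not at hcon
    obtain ⟨m, hm, hmA⟩ := hcon
    exact ⟨m, Finset.mem_filter.2 ⟨hm, by simpa using hmA⟩⟩
  -- Among the monomials of `h` outside the ideal, one of maximal `z`-degree is chosen.
  obtain ⟨m, hmT, hmax⟩ := T.exists_max_image (fun m => m z) hTne
  obtain ⟨hm, hmA⟩ := Finset.mem_filter.1 hmT
  rw [mem_support_iff] at hm
  -- The only possible cancellation of the term `m z` is against `w` times the monomial `m z / w`.
  -- As `w` is free of `z`, that monomial has larger `z`-degree, so by maximality it lies in the
  -- ideal, and so does `m z`.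
  have hz : ∃ a ∈ A, a ≤ m + Finsupp.single z 1 := by
    by_cases hc : coeff (m + Finsupp.single z 1) ((X z - monomial w 1) * h) = 0
    · rw [sub_mul, coeff_sub, mul_comm (X z) h, coeff_mul_X, coeff_monomial_mul', sub_eq_zero] at hc
      split_ifs at hc with hle
      · rw [one_mul] at hc
        set m' := m + Finsupp.single z 1 - w with hm'
        have hm'z : m' z = m z + 1 := by simp [hm', hw]
        have hm'T : m' ∉ T := fun hmem => by
          have := hmax m' hmem
          lia
        have : ∃ a ∈ A, a ≤ m' := by
          by_contra hno
          exact hm'T (Finset.mem_filter.2 ⟨mem_support_iff.2 (hc ▸ hm), hno⟩)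
        obtain ⟨a, ha, ham⟩ := this
        exact ⟨a, ha, ham.trans tsub_le_self⟩
      · exact absurd hc hm
    · exact hh _ (mem_support_iff.2 hc)
  -- If `z` does not divide `m`, then `m w` is free of `z`, so its coefficient in the product is
  -- that of `m` in `h` up to sign, hence nonzero; so `m w` lies in the ideal too and `h2` applies.
  by_cases hmz : m z = 0
  · refine hmA (h2 m hz (hh _ (mem_support_iff.2 ?_)))
    rw [sub_mul, coeff_sub, mul_comm (X z) h, coeff_mul_X', coeff_monomial_mul',
      if_neg (by simp [hmz, hw]), if_pos le_add_self, add_tsub_cancel_right]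
    simpa using hm
  · exact hmA (h1 m hmz hz)

/-- The substitution of monomials for the variables. -/
def monSubst {τ : Type*} (u : σ → τ →₀ ℕ) : MvPolynomial σ K →ₐ[K] MvPolynomial τ K :=
  aeval fun i => monomial (u i) 1

/-- The effect of a substitution of monomials on exponents. -/
def expSubst {τ : Type*} (u : σ → τ →₀ ℕ) (a : σ →₀ ℕ) : τ →₀ ℕ :=
  a.sum fun i m => m • u i

theorem monSubst_X {τ : Type*} (u : σ → τ →₀ ℕ) (i : σ) :
    monSubst u (X i : MvPolynomial σ K) = monomial (u i) 1 :=
  aeval_X _ _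

theorem monSubst_monomial {τ : Type*} (u : σ → τ →₀ ℕ) (a : σ →₀ ℕ) :
    monSubst u (monomial a (1 : K)) = monomial (expSubst u a) 1 := by
  rw [monSubst, aeval_monomial, map_one, one_mul, expSubst, Finsupp.prod, Finsupp.sum,
    monomial_sum_one]
  simp [monomial_pow]

theorem expSubst_apply [Fintype σ] {τ : Type*} (u : σ → τ →₀ ℕ) (a : σ →₀ ℕ) (x : τ) :
    expSubst u a x = ∑ i, a i * u i x := by
  rw [expSubst, Finsupp.sum_fintype _ _ (by simp), Finsupp.finsetSum_apply]
  simp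

theorem monomialSpan_le_comap_monSubst {τ : Type*} (u : σ → τ →₀ ℕ) (A : Set (σ →₀ ℕ)) :
    monomialSpan K A ≤ (monomialSpan K (expSubst u '' A)).comap (monSubst u) := by
  rw [Ideal.span_le]
  rintro _ ⟨a, ha, rfl⟩
  simp only [SetLike.mem_coe, Ideal.mem_comap, monSubst_monomial]
  exact Ideal.subset_span ⟨_, ⟨a, ha, rfl⟩, rfl⟩

end NonZeroDivisor

/-! ### The sequences `z_l - x_{j l} ^ e l` modulo a monomial ideal. -/

section SubstitutionSequence

open RingTheory.Sequence

variable {n r : ℕ} (j : Fin r → Fin n) (e : Fin r → ℕ)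

variable (K) in
/-- The elements `z_l - x_{j l} ^ e l`. -/
def substElem (l : Fin r) : MvPolynomial (Fin n ⊕ Fin r) K :=
  X (Sum.inr l) - X (Sum.inl (j l)) ^ e l

/-- The substitution of `x_{j l} ^ e l` for the variables `z_l` with `l < k`. -/
def partialVec (k : ℕ) : Fin n ⊕ Fin r → (Fin n ⊕ Fin r →₀ ℕ) :=
  Sum.elim (fun i => Finsupp.single (Sum.inl i) 1)
    (fun l => if (l : ℕ) < k then Finsupp.single (Sum.inl (j l)) (e l)
      else Finsupp.single (Sum.inr l) 1)

/-- The substitution of `x_{j l} ^ e l` for all variables `z_l`. -/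
def fullVec : Fin n ⊕ Fin r → (Fin n →₀ ℕ) :=
  Sum.elim (fun i => Finsupp.single i 1) (fun l => Finsupp.single (j l) (e l))

theorem expSubst_partialVec_inl (k : ℕ) (a : Fin n ⊕ Fin r →₀ ℕ) (i : Fin n) :
    expSubst (partialVec j e k) a (Sum.inl i) =
      a (Sum.inl i) + ∑ l : Fin r, if (l : ℕ) < k ∧ j l = i then a (Sum.inr l) * e l else 0 := by
  rw [expSubst_apply, Fintype.sum_sum_type]
  congr 1
  · simp [partialVec, Finsupp.single_apply]
  · refine Finset.sum_congr rfl fun l _ => ?_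
    by_cases h : (l : ℕ) < k <;> simp [partialVec, Finsupp.single_apply, h]

theorem expSubst_partialVec_inr (k : ℕ) (a : Fin n ⊕ Fin r →₀ ℕ) (l : Fin r) :
    expSubst (partialVec j e k) a (Sum.inr l) = if (l : ℕ) < k then 0 else a (Sum.inr l) := by
  rw [expSubst_apply, Fintype.sum_sum_type, Finset.sum_eq_zero (by simp [partialVec]), zero_add,
    Finset.sum_eq_single l]
  · by_cases h : (l : ℕ) < k <;> simp [partialVec, h]
  · intro l' _ hl
    by_cases h : (l' : ℕ) < k <;> simp [partialVec, h, hl]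
  · simp

theorem expSubst_fullVec (a : Fin n ⊕ Fin r →₀ ℕ) (i : Fin n) :
    expSubst (fullVec j e) a i =
      a (Sum.inl i) + ∑ l : Fin r, if j l = i then a (Sum.inr l) * e l else 0 := by
  rw [expSubst_apply, Fintype.sum_sum_type]
  congr 1
  · simp [fullVec, Finsupp.single_apply]
  · exact Finset.sum_congr rfl fun l _ => by simp [fullVec, Finsupp.single_apply]

theorem mem_take_ofFn_iff {α : Type*} {f : Fin r → α} {k : ℕ} {x : α} :
    x ∈ (List.ofFn f).take k ↔ ∃ l : Fin r, (l : ℕ) < k ∧ f l = x := by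
  rw [List.mem_take_iff_getElem]
  simp only [List.length_ofFn, List.getElem_ofFn, lt_inf_iff]
  constructor
  · rintro ⟨i, hi, rfl⟩
    exact ⟨⟨i, hi.2⟩, hi.1, rfl⟩
  · rintro ⟨l, hl, rfl⟩
    exact ⟨l, ⟨hl, l.2⟩, rfl⟩

theorem monSubst_partialVec_X_inl (k : ℕ) (i : Fin n) :
    monSubst (partialVec j e k) (X (Sum.inl i) : MvPolynomial (Fin n ⊕ Fin r) K) =
      X (Sum.inl i) :=
  monSubst_X _ _

theorem monSubst_partialVec_X_inr (k : ℕ) (l : Fin r) :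
    monSubst (partialVec j e k) (X (Sum.inr l) : MvPolynomial (Fin n ⊕ Fin r) K) =
      if (l : ℕ) < k then X (Sum.inl (j l)) ^ e l else X (Sum.inr l) := by
  rw [monSubst_X, partialVec, Sum.elim_inr]
  split_ifs
  · rw [X_pow_eq_monomial]
  · rfl

theorem sub_monSubst_partialVec_mem (k : ℕ) (p : MvPolynomial (Fin n ⊕ Fin r) K) :
    p - monSubst (partialVec j e k) p ∈
      Ideal.ofList ((List.ofFn (substElem K j e)).take k) := by
  refine sub_algHom_mem _ (fun x => ?_) p
  rcases x with i | l
  · rw [monSubst_partialVec_X_inl, sub_self]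
    exact zero_mem _
  · rw [monSubst_partialVec_X_inr]
    split_ifs with h
    · exact Ideal.subset_span (mem_take_ofFn_iff.2 ⟨l, h, rfl⟩)
    · rw [sub_self]
      exact zero_mem _

theorem monSubst_partialVec_substElem (k : ℕ) (l : Fin r) :
    monSubst (partialVec j e k) (substElem K j e l) =
      if (l : ℕ) < k then 0 else substElem K j e l := by
  rw [substElem, map_sub, map_pow, monSubst_partialVec_X_inl, monSubst_partialVec_X_inr]
  split_ifs <;> simp

/-- The substitution kills the first `k` elements and changes each polynomial only by a member of
the ideal they generate. Thus every stage of the sequence reduces to a question about a monomial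
ideal. -/
theorem mem_sup_iff_monSubst_partialVec_mem (A : Set (Fin n ⊕ Fin r →₀ ℕ)) (k : ℕ)
    (p : MvPolynomial (Fin n ⊕ Fin r) K) :
    p ∈ monomialSpan K A ⊔ Ideal.ofList ((List.ofFn (substElem K j e)).take k) ↔
      monSubst (partialVec j e k) p ∈ monomialSpan K (expSubst (partialVec j e k) '' A) := by
  constructor
  · intro hp
    refine (sup_le (monomialSpan_le_comap_monSubst _ A) (Ideal.span_le.2 ?_) :
      _ ≤ (monomialSpan K (expSubst (partialVec j e k) '' A)).comap
        (monSubst (partialVec j e k))) hp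
    intro q hq
    obtain ⟨l, hl, rfl⟩ := mem_take_ofFn_iff.1 hq
    simp [monSubst_partialVec_substElem, hl]
  · intro hp
    have hF := fun q => (le_sup_right : _ ≤ monomialSpan K A ⊔ _)
      (sub_monSubst_partialVec_mem (K := K) j e k q)
    have hle : monomialSpan K (expSubst (partialVec j e k) '' A) ≤
        monomialSpan K A ⊔ Ideal.ofList ((List.ofFn (substElem K j e)).take k) := by
      rw [Ideal.span_le]
      rintro _ ⟨_, ⟨a, ha, rfl⟩, rfl⟩
      have h1 : monomial a (1 : K) ∈
          monomialSpan K A ⊔ Ideal.ofList ((List.ofFn (substElem K j e)).take k) :=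
        le_sup_left (a := monomialSpan K A) (Ideal.subset_span ⟨a, ha, rfl⟩)
      have h2 := sub_mem h1 (hF (monomial a 1))
      rwa [sub_sub_cancel, monSubst_monomial] at h2
    have := add_mem (hF p) (hle hp)
    rwa [sub_add_cancel] at this

theorem mk_mem_smul_top_iff {S : Type*} [CommRing S] {P Q : Ideal S} {x : S} :
    (Submodule.Quotient.mk x : S ⧸ P) ∈ (Q • ⊤ : Submodule S (S ⧸ P)) ↔ x ∈ P ⊔ Q := by
  have h : (Q • ⊤ : Submodule S (S ⧸ P)) = Submodule.map P.mkQ Q := by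
    rw [← Submodule.range_mkQ P, ← Submodule.map_top, ← Submodule.map_smul'']
    simp
  rw [h, ← Submodule.mkQ_apply, ← Submodule.mem_comap, Submodule.comap_map_mkQ]

/-- A criterion for the elements `z_l - x_{j l} ^ e l` to form a weakly regular sequence modulo a
monomial ideal. -/
theorem isWeaklyRegular_ofFn_substElem {A : Set (Fin n ⊕ Fin r →₀ ℕ)}
    (hA1 : ∀ a ∈ A, ∀ l, a (Sum.inr l) ≤ 1)
    (hA2 : ∀ k : Fin r, ∀ a ∈ A, ∀ b ∈ A, a (Sum.inr k) = 0 → b (Sum.inr k) ≠ 0 →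
      expSubst (partialVec j e k) a (Sum.inl (j k)) ≤
        expSubst (partialVec j e k) b (Sum.inl (j k))) :
    IsWeaklyRegular (MvPolynomial (Fin n ⊕ Fin r) K ⧸ monomialSpan K A)
      (List.ofFn (substElem K j e)) where
  regular_mod_prev i hi := by
    rw [List.length_ofFn] at hi
    rw [List.getElem_ofFn, isSMulRegular_quotient_iff_mem_of_smul_mem]
    intro x
    obtain ⟨x, rfl⟩ := Submodule.Quotient.mk_surjective _ x
    rw [← Submodule.Quotient.mk_smul, mk_mem_smul_top_iff, mk_mem_smul_top_iff,
      mem_sup_iff_monSubst_partialVec_mem, mem_sup_iff_monSubst_partialVec_mem, smul_eq_mul,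
      map_mul, monSubst_partialVec_substElem, if_neg (lt_irrefl _), substElem, X_pow_eq_monomial]
    set k : Fin r := ⟨i, hi⟩ with hk
    have hinr : ∀ a, expSubst (partialVec j e i) a (Sum.inr k) = a (Sum.inr k) := fun a => by
      rw [expSubst_partialVec_inr, if_neg (lt_irrefl _)]
    -- The exponent of `z_k` in `b` is at most 1, so the extra factor `z_k` is needed only if `b`
    -- contains `z_k` and `m` does not.
    have hb1 : ∀ b ∈ expSubst (partialVec j e i) '' A, ∀ m : Fin n ⊕ Fin r →₀ ℕ,
        m (Sum.inr k) ≠ 0 ∨ b (Sum.inr k) = 0 → b ≤ m + Finsupp.single (Sum.inr k) 1 → b ≤ m := by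
      rintro _ ⟨a, ha, rfl⟩ m hm hle x
      rcases eq_or_ne x (Sum.inr k) with rfl | hx
      · have := hA1 a ha k
        rw [hinr] at hm ⊢
        lia
      · simpa [Finsupp.single_apply, hx.symm] using hle x
    refine mem_of_X_sub_monomial_mul_mem (by simp) ?_ ?_
    · rintro m hm ⟨b, hb, hle⟩
      exact ⟨b, hb, hb1 b hb m (.inl hm) hle⟩
    · rintro m ⟨b, hb, hbm⟩ ⟨a, ha, ham⟩
      by_cases hcase : m (Sum.inr k) ≠ 0 ∨ b (Sum.inr k) = 0
      · exact ⟨b, hb, hb1 b hb m hcase hbm⟩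
      push Not at hcase
      obtain ⟨hm0, hb0⟩ := hcase
      -- Now `a`, which divides `m w`, divides `m` itself: the two differ only at `x_{j k}`, where
      -- the exponent of `a` is at most that of `b`, and `b` divides `m z_k`.
      refine ⟨a, ha, fun x => ?_⟩
      rcases eq_or_ne x (Sum.inl (j k)) with rfl | hx
      · obtain ⟨a, haA, rfl⟩ := ha
        obtain ⟨b, hbA, rfl⟩ := hb
        rw [hinr] at hb0
        have ha0 : a (Sum.inr k) = 0 := by
          have := ham (Sum.inr k)
          rw [hinr] at this
          simpa [hm0] using this
        refine (hA2 k a haA b hbA ha0 hb0).trans ?_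
        simpa using hbm (Sum.inl (j k))
      · simpa [Finsupp.single_apply, hx.symm] using ham x

end SubstitutionSequence

/-! ### The quotient by the whole sequence, and its depth. -/

section FullSubstitution

open RingTheory.Sequence

variable {n r : ℕ} (j : Fin r → Fin n) (e : Fin r → ℕ)

theorem monSubst_fullVec_rename (p : MvPolynomial (Fin n) K) :
    monSubst (fullVec j e) (rename Sum.inl p) = p := by
  have : (monSubst (fullVec j e)).comp (rename Sum.inl) = AlgHom.id K (MvPolynomial (Fin n) K) := by
    ext i
    rw [AlgHom.comp_apply, rename_X, monSubst_X]
    rfl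
  exact DFunLike.congr_fun this p

theorem monSubst_fullVec_substElem (l : Fin r) :
    monSubst (fullVec j e) (substElem K j e l) = 0 := by
  rw [substElem, map_sub, map_pow, monSubst_X, monSubst_X, monomial_pow]
  simp [fullVec]

theorem sub_rename_monSubst_fullVec_mem (p : MvPolynomial (Fin n ⊕ Fin r) K) :
    p - rename Sum.inl (monSubst (fullVec j e) p) ∈
      Ideal.span (Set.range (substElem K j e)) := by
  refine sub_algHom_mem ((rename Sum.inl).comp (monSubst (fullVec j e))) (fun x => ?_) p
  rcases x with i | l
  · have : monSubst (fullVec j e) (X (Sum.inl i) : MvPolynomial (Fin n ⊕ Fin r) K) = X i :=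
      monSubst_X _ _
    rw [AlgHom.comp_apply, this, rename_X, sub_self]
    exact zero_mem _
  · have : monSubst (fullVec j e) (X (Sum.inr l) : MvPolynomial (Fin n ⊕ Fin r) K) =
        X (j l) ^ e l := by
      rw [monSubst_X, X_pow_eq_monomial]
      rfl
    rw [AlgHom.comp_apply, this, map_pow, rename_X]
    exact Ideal.subset_span ⟨l, rfl⟩

theorem mem_sup_iff_monSubst_fullVec_mem (A : Set (Fin n ⊕ Fin r →₀ ℕ))
    (p : MvPolynomial (Fin n ⊕ Fin r) K) :
    p ∈ monomialSpan K A ⊔ Ideal.span (Set.range (substElem K j e)) ↔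
      monSubst (fullVec j e) p ∈ monomialSpan K (expSubst (fullVec j e) '' A) := by
  have hF := fun q => (le_sup_right : _ ≤ monomialSpan K A ⊔ _)
    (sub_rename_monSubst_fullVec_mem (K := K) j e q)
  constructor
  · intro hp
    refine (sup_le (monomialSpan_le_comap_monSubst _ A) (Ideal.span_le.2 ?_) :
      _ ≤ (monomialSpan K (expSubst (fullVec j e) '' A)).comap (monSubst (fullVec j e))) hp
    rintro _ ⟨l, rfl⟩
    simp [monSubst_fullVec_substElem]
  · intro hp
    have hle : monomialSpan K (expSubst (fullVec j e) '' A) ≤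
        (monomialSpan K A ⊔ Ideal.span (Set.range (substElem K j e))).comap
          (rename (R := K) Sum.inl) := by
      rw [Ideal.span_le]
      rintro _ ⟨_, ⟨a, ha, rfl⟩, rfl⟩
      have h1 : monomial a (1 : K) ∈
          monomialSpan K A ⊔ Ideal.span (Set.range (substElem K j e)) :=
        le_sup_left (a := monomialSpan K A) (Ideal.subset_span ⟨a, ha, rfl⟩)
      have h2 := sub_mem h1 (hF (monomial a 1))
      rwa [sub_sub_cancel, monSubst_monomial] at h2
    have := add_mem (hF p) (hle hp)
    rwa [sub_add_cancel] at this

theorem rename_mem_sup_iff (A : Set (Fin n ⊕ Fin r →₀ ℕ)) (p : MvPolynomial (Fin n) K) :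
    rename Sum.inl p ∈ monomialSpan K A ⊔ Ideal.span (Set.range (substElem K j e)) ↔
      p ∈ monomialSpan K (expSubst (fullVec j e) '' A) := by
  rw [mem_sup_iff_monSubst_fullVec_mem, monSubst_fullVec_rename]

/-- The inverse of the map induced by the inclusion is the substitution for all the `z_l`. -/
theorem quotientEq_substElem (A : Set (Fin n ⊕ Fin r →₀ ℕ)) :
    QuotientEq (monomialSpan K A) (substElem K j e)
      (monomialSpan K (expSubst (fullVec j e) '' A)) := by
  set P := monomialSpan K A
  set F : Ideal (MvPolynomial (Fin n ⊕ Fin r) K ⧸ P) :=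
    Ideal.span (Set.range fun k => Ideal.Quotient.mk P (substElem K j e k)) with hF
  have hmem : ∀ q, Ideal.Quotient.mk F (Ideal.Quotient.mk P q) = 0 ↔
      q ∈ P ⊔ Ideal.span (Set.range (substElem K j e)) := by
    intro q
    have : F = (Ideal.span (Set.range (substElem K j e))).map (Ideal.Quotient.mk P) := by
      rw [Ideal.map_span, ← Set.range_comp]
      rfl
    rw [Ideal.Quotient.eq_zero_iff_mem, this, ← Ideal.mem_comap,
      Ideal.comap_map_of_surjective _ Ideal.Quotient.mk_surjective, ← RingHom.ker_eq_comap_bot,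
      Ideal.mk_ker, sup_comm]
  set g : MvPolynomial (Fin n) K →ₐ[K] (MvPolynomial (Fin n ⊕ Fin r) K ⧸ P) ⧸ F :=
    ((Ideal.Quotient.mkₐ K F).comp (Ideal.Quotient.mkₐ K P)).comp (rename Sum.inl) with hg
  have hgmem : ∀ q, g q = 0 ↔ q ∈ monomialSpan K (expSubst (fullVec j e) '' A) := fun q =>
    (hmem _).trans (rename_mem_sup_iff j e A q)
  refine ⟨AlgEquiv.ofBijective
    (Ideal.Quotient.liftₐ _ g fun q hq => (hgmem q).2 hq) ⟨?_, ?_⟩, fun a => rfl⟩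
  · rw [injective_iff_map_eq_zero]
    intro q hq
    obtain ⟨q, rfl⟩ := Ideal.Quotient.mk_surjective q
    exact Ideal.Quotient.eq_zero_iff_mem.2 ((hgmem q).1 hq)
  · intro y
    obtain ⟨y, rfl⟩ := Ideal.Quotient.mk_surjective y
    obtain ⟨y, rfl⟩ := Ideal.Quotient.mk_surjective y
    refine ⟨Ideal.Quotient.mk _ (monSubst (fullVec j e) y), ?_⟩
    refine (sub_eq_zero.1 ?_).symm
    have := (hmem _).2 (Ideal.mem_sup_right (sub_rename_monSubst_fullVec_mem (K := K) j e y))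
    rwa [map_sub, map_sub] at this

theorem ofList_ofFn {R : Type*} [CommSemiring R] (f : Fin r → R) :
    Ideal.ofList (List.ofFn f) = Ideal.span (Set.range f) :=
  congrArg Ideal.span (Set.ext fun x => by simp [List.mem_ofFn])

theorem monomialSpan_le_idealOfVars {σ : Type*} {A : Set (σ →₀ ℕ)} (hA : 0 ∉ A) :
    monomialSpan K A ≤ idealOfVars σ K := by
  classical
  rw [Ideal.span_le]
  rintro _ ⟨a, ha, rfl⟩
  rw [idealOfVars, ← Set.image_univ, SetLike.mem_coe, mem_ideal_span_X_image]
  intro m hm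
  rw [support_monomial, if_neg one_ne_zero, Finset.mem_singleton] at hm
  subst hm
  by_contra! h
  exact hA (by rwa [show m = 0 from Finsupp.ext fun i => h i trivial] at ha)

theorem idealOfVars_ne_top {σ : Type*} : idealOfVars σ K ≠ ⊤ := by
  rw [idealOfVars, ← Set.image_univ]
  exact (isPrime_span_X_image _).ne_top

theorem idealOfVars_smul_top_ne {σ : Type*} {A : Set (σ →₀ ℕ)} (hA : 0 ∉ A) :
    idealOfVars σ K • (⊤ : Submodule (MvPolynomial σ K) (MvPolynomial σ K ⧸ monomialSpan K A)) ≠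
      ⊤ := by
  intro h
  have h1 : (Submodule.Quotient.mk 1 : MvPolynomial σ K ⧸ monomialSpan K A) ∈
      (⊤ : Submodule (MvPolynomial σ K) (MvPolynomial σ K ⧸ monomialSpan K A)) := trivial
  rw [← h, mk_mem_smul_top_iff, sup_eq_right.2 (monomialSpan_le_idealOfVars hA),
    ← Ideal.eq_top_iff_one] at h1
  exact idealOfVars_ne_top h1

theorem substElem_mem_idealOfVars (he : ∀ l, e l ≠ 0) (l : Fin r) :
    substElem K j e l ∈ idealOfVars (Fin n ⊕ Fin r) K :=
  sub_mem (Ideal.subset_span (Set.mem_range_self _))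
    (Ideal.pow_mem_of_mem _ (Ideal.subset_span (Set.mem_range_self _)) _ (Nat.pos_of_ne_zero (he l)))

theorem zero_notMem_image_expSubst_fullVec {A : Set (Fin n ⊕ Fin r →₀ ℕ)} (hA : 0 ∉ A)
    (he : ∀ l, e l ≠ 0) : (0 : Fin n →₀ ℕ) ∉ expSubst (fullVec j e) '' A := by
  rintro ⟨a, ha, h0⟩
  refine hA ?_
  rwa [show (0 : Fin n ⊕ Fin r →₀ ℕ) = a from ?_]
  have h : ∀ i, a (Sum.inl i) = 0 ∧ ∀ l, j l = i → a (Sum.inr l) = 0 := by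
    intro i
    have := expSubst_fullVec j e a i
    rw [h0, Finsupp.zero_apply, eq_comm, Nat.add_eq_zero_iff, Finset.sum_eq_zero_iff] at this
    refine ⟨this.1, fun l hl => ?_⟩
    have h2 := this.2 l (Finset.mem_univ l)
    rw [if_pos hl] at h2
    exact (Nat.mul_eq_zero.1 h2).resolve_right (he l)
  ext x
  rcases x with i | l
  · exact (h i).1.symm
  · exact ((h _).2 l rfl).symm

/-- A change of rings: the two modules are isomorphic as groups, compatibly with the substitution in
one direction and with the inclusion in the other. Sequences are carried along these maps; `he`
keeps the images of the `z_l` inside the ideal of the variables. -/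
theorem hasWeaklyRegularSeq_quotient_substElem_iff (he : ∀ l, e l ≠ 0)
    (A : Set (Fin n ⊕ Fin r →₀ ℕ)) (m : ℕ) :
    HasWeaklyRegularSeq (idealOfVars (Fin n ⊕ Fin r) K)
      ((MvPolynomial (Fin n ⊕ Fin r) K ⧸ monomialSpan K A) ⧸
        (Ideal.ofList (List.ofFn (substElem K j e)) • ⊤ :
          Submodule (MvPolynomial (Fin n ⊕ Fin r) K)
            (MvPolynomial (Fin n ⊕ Fin r) K ⧸ monomialSpan K A))) m ↔
    HasWeaklyRegularSeq (idealOfVars (Fin n) K)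
      (MvPolynomial (Fin n) K ⧸ monomialSpan K (expSubst (fullVec j e) '' A)) m := by
  set F : Submodule (MvPolynomial (Fin n ⊕ Fin r) K)
      (MvPolynomial (Fin n ⊕ Fin r) K ⧸ monomialSpan K A) :=
    Ideal.ofList (List.ofFn (substElem K j e)) • ⊤ with hF
  set L := monomialSpan K (expSubst (fullVec j e) '' A) with hL
  have hmem : ∀ q, (Submodule.Quotient.mk (Submodule.Quotient.mk q) :
      (MvPolynomial (Fin n ⊕ Fin r) K ⧸ monomialSpan K A) ⧸ F) = 0 ↔
      q ∈ monomialSpan K A ⊔ Ideal.span (Set.range (substElem K j e)) := fun q => by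
    rw [Submodule.Quotient.mk_eq_zero, hF, mk_mem_smul_top_iff, ofList_ofFn]
  let ι : MvPolynomial (Fin n) K →+* MvPolynomial (Fin n ⊕ Fin r) K :=
    (rename Sum.inl : MvPolynomial (Fin n) K →ₐ[K] _).toRingHom
  let g : MvPolynomial (Fin n) K →ₛₗ[ι]
      (MvPolynomial (Fin n ⊕ Fin r) K ⧸ monomialSpan K A) ⧸ F :=
    { toFun := fun p => Submodule.Quotient.mk (Submodule.Quotient.mk (rename Sum.inl p))
      map_add' := fun p q => by rw [map_add]; rfl
      map_smul' := fun p q => by rw [smul_eq_mul, map_mul]; rfl }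
  have hgmem : ∀ q, g q = 0 ↔ q ∈ L := fun q =>
    (hmem _).trans (rename_mem_sup_iff j e A q)
  have hgφ : ∀ y, g (monSubst (fullVec j e) y) =
      Submodule.Quotient.mk (Submodule.Quotient.mk y) := by
    intro y
    refine (sub_eq_zero.1 ?_).symm
    exact (hmem _).2 (Ideal.mem_sup_right (sub_rename_monSubst_fullVec_mem (K := K) j e y))
  let G := Submodule.liftQ L g fun q hq => (hgmem q).2 hq
  have hG : Function.Bijective G := by
    constructor
    · rw [injective_iff_map_eq_zero]
      intro q hq
      obtain ⟨q, rfl⟩ := Submodule.Quotient.mk_surjective _ q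
      exact (Submodule.Quotient.mk_eq_zero _).2 ((hgmem q).1 hq)
    · intro y
      obtain ⟨y, rfl⟩ := Submodule.Quotient.mk_surjective _ y
      obtain ⟨y, rfl⟩ := Submodule.Quotient.mk_surjective _ y
      exact ⟨Submodule.Quotient.mk (monSubst (fullVec j e) y), hgφ y⟩
  let E := AddEquiv.ofBijective G.toAddMonoidHom hG
  have hE : ∀ (s : MvPolynomial (Fin n ⊕ Fin r) K) (x : MvPolynomial (Fin n) K ⧸ L),
      E (monSubst (fullVec j e) s • x) = s • E x := by
    intro s x
    obtain ⟨x, rfl⟩ := Submodule.Quotient.mk_surjective _ x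
    change g (monSubst (fullVec j e) s * x) = s • g x
    conv_lhs => rw [← monSubst_fullVec_rename (K := K) j e x, ← map_mul, hgφ]
    rfl
  constructor
  · rintro ⟨rs, hl, hJ, hreg⟩
    refine ⟨rs.map (monSubst (fullVec j e)), by simpa using hl, ?_, ?_⟩
    · intro a ha
      obtain ⟨b, hb, rfl⟩ := List.mem_map.1 ha
      have : idealOfVars (Fin n ⊕ Fin r) K ≤
          (idealOfVars (Fin n) K).comap (monSubst (fullVec j e)) := by
        rw [idealOfVars, Ideal.span_le]
        rintro _ ⟨i | l, rfl⟩
        · rw [SetLike.mem_coe, Ideal.mem_comap, monSubst_X]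
          exact Ideal.subset_span ⟨i, rfl⟩
        · rw [SetLike.mem_coe, Ideal.mem_comap, monSubst_X, fullVec, Sum.elim_inr,
            ← X_pow_eq_monomial]
          exact Ideal.pow_mem_of_mem _ (Ideal.subset_span (Set.mem_range_self _)) _ (Nat.pos_of_ne_zero (he l))
      exact this (hJ b hb)
    · refine (AddEquiv.isWeaklyRegular_congr (e := E) ?_).2 hreg
      rw [List.forall₂_map_left_iff, List.forall₂_same]
      exact fun s _ x => hE s x
  · rintro ⟨rs, hl, hJ, hreg⟩
    refine ⟨rs.map (rename Sum.inl), by simpa using hl, ?_, ?_⟩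
    · intro a ha
      obtain ⟨b, hb, rfl⟩ := List.mem_map.1 ha
      have : idealOfVars (Fin n) K ≤
          (idealOfVars (Fin n ⊕ Fin r) K).comap (rename (R := K) Sum.inl) := by
        rw [idealOfVars, Ideal.span_le]
        rintro _ ⟨i, rfl⟩
        rw [SetLike.mem_coe, Ideal.mem_comap, rename_X]
        exact Ideal.subset_span ⟨_, rfl⟩
      exact this (hJ b hb)
    · refine (AddEquiv.isWeaklyRegular_congr (e := E) ?_).1 hreg
      rw [List.forall₂_map_right_iff, List.forall₂_same]
      intro s _ x
      rw [← hE, monSubst_fullVec_rename]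

theorem quotDepth_eq_add {A : Set (Fin n ⊕ Fin r →₀ ℕ)} (hA : 0 ∉ A) (he : ∀ l, e l ≠ 0)
    (hreg : IsWeaklyRegular (MvPolynomial (Fin n ⊕ Fin r) K ⧸ monomialSpan K A)
      (List.ofFn (substElem K j e))) :
    quotDepth (monomialSpan K A) =
      quotDepth (monomialSpan K (expSubst (fullVec j e) '' A)) + r := by
  have hmem : ∀ a ∈ List.ofFn (substElem K j e), a ∈ idealOfVars (Fin n ⊕ Fin r) K := by
    intro a ha
    obtain ⟨l, rfl⟩ := List.mem_ofFn.1 ha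
    exact substElem_mem_idealOfVars j e he l
  refine depth_eq_add_of_hasWeaklyRegularSeq_iff (idealOfVars_smul_top_ne hA)
    (idealOfVars_smul_top_ne (zero_notMem_image_expSubst_fullVec j e hA he)) r
    ⟨_, List.length_ofFn, hmem, hreg⟩ fun m => ?_
  have := hasWeaklyRegularSeq_add_length_iff (n := m) _ hmem hreg
  rw [List.length_ofFn] at this
  rw [this, hasWeaklyRegularSeq_quotient_substElem_iff j e he]

theorem isRegular_substElem_of_isWeaklyRegular {A : Set (Fin n ⊕ Fin r →₀ ℕ)} (hA : 0 ∉ A)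
    (he : ∀ l, e l ≠ 0)
    (hreg : IsWeaklyRegular (MvPolynomial (Fin n ⊕ Fin r) K ⧸ monomialSpan K A)
      (List.ofFn (substElem K j e))) :
    IsRegular (MvPolynomial (Fin n ⊕ Fin r) K ⧸ monomialSpan K A)
      (List.ofFn (substElem K j e)) := by
  refine isRegular_of_isWeaklyRegular_of_smul_top_ne (idealOfVars_smul_top_ne hA) ?_ hreg
  intro a ha
  obtain ⟨l, rfl⟩ := List.mem_ofFn.1 ha
  exact substElem_mem_idealOfVars j e he l

theorem isRegular_mvPolynomial_substElem (he : ∀ l, e l ≠ 0) :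
    IsRegular (MvPolynomial (Fin n ⊕ Fin r) K) (List.ofFn (substElem K j e)) := by
  -- The polynomial ring is the case of no generators, where the criterion is vacuous.
  have h0 : monomialSpan K (∅ : Set (Fin n ⊕ Fin r →₀ ℕ)) = ⊥ := by simp
  refine ((Submodule.quotEquivOfEqBot _ h0).isRegular_congr _).1 ?_
  exact isRegular_substElem_of_isWeaklyRegular j e (by simp) he
    (isWeaklyRegular_ofFn_substElem j e (by simp) (by simp))

end FullSubstitution

/-! ### Combinatorics of a single row and its gaps. -/

section Row

/-- `s < t` are consecutive elements of `R` with `t - s ≥ 2`. -/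
def IsGap (R : Set ℕ) (s t : ℕ) : Prop :=
  s ∈ R ∧ t ∈ R ∧ s + 2 ≤ t ∧ ∀ m ∈ R, m ≤ s ∨ t ≤ m

/-- Induction along consecutive elements: as `0 ∈ R`, each positive element has an immediate
predecessor in `R`. -/
theorem row_induction {R : Set ℕ} {p : ℕ → Prop} (zero : p 0)
    (step : ∀ w ∈ R, ∀ v ∈ R, w < v → (∀ m ∈ R, m ≤ w ∨ v ≤ m) → p w → p v) (h0 : 0 ∈ R) :
    ∀ v ∈ R, p v := by
  intro v
  induction v using Nat.strong_induction_on with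
  | _ v ih =>
    intro hv
    rcases Nat.eq_zero_or_pos v with rfl | hpos
    · exact zero
    obtain ⟨w, ⟨hw, hwv⟩, hmax⟩ := Set.exists_max_image {m | m ∈ R ∧ m < v} id
      ((Set.finite_Iio v).subset fun m hm => hm.2) ⟨0, h0, hpos⟩
    refine step w hw v hv hwv (fun m hm => ?_) (ih w hwv hw)
    by_contra! hcon
    exact absurd (hmax m ⟨hm, hcon.2⟩) (not_le.2 hcon.1)

variable {n r : ℕ}

/-- The total weight of the thresholds at the variable `i` which are at most `m`. -/
def reduction (j : Fin r → Fin n) (c t : Fin r → ℕ) (i : Fin n) (m : ℕ) : ℕ :=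
  ∑ l, if j l = i ∧ t l ≤ m then c l else 0

/-- The exponent `m` of the variable `i`, reduced by the weights of the thresholds below `m`. -/
def reduced (j : Fin r → Fin n) (c t : Fin r → ℕ) (i : Fin n) (m : ℕ) : ℕ :=
  m - reduction j c t i m

/-- The gaps of widths `d l`, ending at the entries `t l` of the rows `j l`, are distinct, and with
every gap they contain all lower gaps of the same row. -/
structure IsGapFamily (R : Fin n → Set ℕ) (j : Fin r → Fin n) (d t : Fin r → ℕ) : Prop where
  zero_mem : ∀ i, 0 ∈ R i
  gap : ∀ l, ∃ s, IsGap (R (j l)) s (t l) ∧ s + d l = t l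
  inj : ∀ l l', j l = j l' → t l = t l' → l = l'
  closed : ∀ l s t', IsGap (R (j l)) s t' → t' ≤ t l → ∃ l', j l' = j l ∧ t l' = t'

namespace IsGapFamily

variable {R : Fin n → Set ℕ} {j : Fin r → Fin n} {d t : Fin r → ℕ}

theorem two_le (h : IsGapFamily R j d t) (l : Fin r) : 2 ≤ d l := by
  obtain ⟨s, hs, hd⟩ := h.gap l
  have := hs.2.2.1
  lia

theorem t_mem (h : IsGapFamily R j d t) (l : Fin r) : t l ∈ R (j l) := by
  obtain ⟨s, hs, -⟩ := h.gap l
  exact hs.2.1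

theorem t_pos (h : IsGapFamily R j d t) (l : Fin r) : 0 < t l := by
  obtain ⟨s, hs, -⟩ := h.gap l
  have := hs.2.2.1
  lia

theorem reduction_zero (h : IsGapFamily R j d t) (c : Fin r → ℕ) (i : Fin n) :
    reduction j c t i 0 = 0 :=
  Finset.sum_eq_zero fun l _ => if_neg fun hl => (h.t_pos l).not_ge hl.2

theorem reduction_eq_of_forall_ne (h : IsGapFamily R j d t) (c : Fin r → ℕ) {i : Fin n} {w v : ℕ}
    (hwv : w < v) (hc : ∀ m ∈ R i, m ≤ w ∨ v ≤ m) (hne : ∀ l, j l = i → t l ≠ v) :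
    reduction j c t i v = reduction j c t i w := by
  refine Finset.sum_congr rfl fun l _ => if_congr (and_congr_right fun hl => ?_) rfl rfl
  have h1 := hne l hl
  have h2 := hc (t l) (hl ▸ h.t_mem l)
  lia

theorem reduction_eq_add (h : IsGapFamily R j d t) (c : Fin r → ℕ) {w v : ℕ} {l : Fin r}
    (hwv : w < v) (hc : ∀ m ∈ R (j l), m ≤ w ∨ v ≤ m) (hl : t l = v) :
    reduction j c t (j l) v = reduction j c t (j l) w + c l := by
  have : c l = ∑ l', if l' = l then c l' else 0 := by simp
  rw [reduction, reduction, this, ← Finset.sum_add_distrib]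
  refine Finset.sum_congr rfl fun l' _ => ?_
  rcases eq_or_ne l' l with rfl | hne
  · simp [hl, hwv]
  · rw [if_neg hne, add_zero]
    refine if_congr (and_congr_right fun hl' => ?_) rfl rfl
    have h1 : t l' ≠ v := fun h' => hne (h.inj _ _ hl' (h'.trans hl.symm))
    have h2 := hc (t l') (hl' ▸ h.t_mem l')
    lia

theorem width_eq (h : IsGapFamily R j d t) {w v : ℕ} {l : Fin r} (hw : w ∈ R (j l))
    (hwv : w < v) (hc : ∀ m ∈ R (j l), m ≤ w ∨ v ≤ m) (hl : t l = v) : w + d l = v := by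
  obtain ⟨s, ⟨hs, -, hst, hgap⟩, hd⟩ := h.gap l
  have h1 := hc s hs
  have h2 := hgap w hw
  lia

/-- The change of the reduction between consecutive elements of a row. -/
theorem reduction_step (h : IsGapFamily R j d t) (c : Fin r → ℕ) {i : Fin n} {w v : ℕ}
    (hw : w ∈ R i) (hwv : w < v) (hc : ∀ m ∈ R i, m ≤ w ∨ v ≤ m) :
    ((∀ l, j l = i → t l ≠ v) ∧ reduction j c t i v = reduction j c t i w) ∨
      ∃ l, w + d l = v ∧ reduction j c t i v = reduction j c t i w + c l := by
  by_cases hex : ∃ l, j l = i ∧ t l = v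
  · obtain ⟨l, rfl, hl⟩ := hex
    exact .inr ⟨l, h.width_eq hw hwv hc hl, h.reduction_eq_add c hwv hc hl⟩
  · push Not at hex
    exact .inl ⟨hex, h.reduction_eq_of_forall_ne c hwv hc hex⟩

/-- From an entry `w` to the next entry `v`, the reduced exponent grows by `v - w`, or by `d l - c l
≥ 0` if a recorded gap ends at `v`. Both claims are carried through one induction because truncated
subtraction needs the first. -/
theorem reduction_le_and_reduced_mono (h : IsGapFamily R j d t) {c : Fin r → ℕ}
    (hcd : ∀ l, c l ≤ d l) (i : Fin n) :
    ∀ v ∈ R i, reduction j c t i v ≤ v ∧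
      ∀ u ∈ R i, u ≤ v → reduced j c t i u ≤ reduced j c t i v := by
  refine row_induction ?_ ?_ (h.zero_mem i)
  · rw [h.reduction_zero]
    refine ⟨le_rfl, fun u _ hu => ?_⟩
    rw [Nat.le_zero.1 hu]
  · rintro w hw v hv hwv hc ⟨ih1, ih2⟩
    have key : reduction j c t i v ≤ v ∧ reduced j c t i w ≤ reduced j c t i v := by
      unfold reduced
      rcases h.reduction_step c hw hwv hc with ⟨-, h1⟩ | ⟨l, h1, h2⟩
      · lia
      · have := hcd l
        lia
    refine ⟨key.1, fun u hu huv => ?_⟩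
    rcases hc u hu with h1 | h1
    · exact (ih2 u hu h1).trans key.2
    · rw [le_antisymm huv h1]

theorem reduction_le (h : IsGapFamily R j d t) {c : Fin r → ℕ}
    (hcd : ∀ l, c l ≤ d l) {i : Fin n} {v : ℕ} (hv : v ∈ R i) : reduction j c t i v ≤ v :=
  (h.reduction_le_and_reduced_mono hcd i v hv).1

theorem reduced_mono (h : IsGapFamily R j d t) {c : Fin r → ℕ}
    (hcd : ∀ l, c l ≤ d l) {i : Fin n} {u v : ℕ} (hu : u ∈ R i) (hv : v ∈ R i) (huv : u ≤ v) :
    reduced j c t i u ≤ reduced j c t i v :=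
  (h.reduction_le_and_reduced_mono hcd i v hv).2 u hu huv

theorem reduced_strictMono (h : IsGapFamily R j d t) {c : Fin r → ℕ}
    (hcd : ∀ l, c l < d l) {i : Fin n} {u v : ℕ} (hu : u ∈ R i) (hv : v ∈ R i) (huv : u < v) :
    reduced j c t i u < reduced j c t i v := by
  revert v
  suffices ∀ v ∈ R i, u < v → reduced j c t i u < reduced j c t i v from fun {v} => this v
  refine row_induction (by simp) ?_ (h.zero_mem i)
  intro w hw v hv hwv hc ih huv
  have key : reduced j c t i w < reduced j c t i v := by
    have hle := h.reduction_le (fun l => (hcd l).le) hw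
    unfold reduced
    rcases h.reduction_step c hw hwv hc with ⟨-, h1⟩ | ⟨l, h1, h2⟩
    · lia
    · have := hcd l
      lia
  rcases (hc u hu).resolve_right (by lia) |>.lt_or_eq with h1 | rfl
  · exact (ih h1).trans key
  · exact key

theorem reduced_zero (h : IsGapFamily R j d t) (c : Fin r → ℕ) (i : Fin n) :
    reduced j c t i 0 = 0 := by
  rw [reduced, h.reduction_zero]

/-- If all gaps of row `i` up to `s` belong to the family, the reduced exponents have no gap up to
`s`. -/
theorem exists_reduced_eq (h : IsGapFamily R j d t) {c : Fin r → ℕ} (hcd : ∀ l, d l ≤ c l + 1)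
    {i : Fin n} :
    ∀ s ∈ R i, (∀ s' t', IsGap (R i) s' t' → t' ≤ s → ∃ l, j l = i ∧ t l = t') →
      ∀ m ≤ reduced j c t i s, ∃ v ∈ R i, reduced j c t i v = m := by
  refine row_induction ?_ ?_ (h.zero_mem i)
  · intro _ m hm
    rw [h.reduced_zero, Nat.le_zero] at hm
    exact ⟨0, h.zero_mem i, by rw [h.reduced_zero, hm]⟩
  · intro w hw v hv hwv hc ih hall m hm
    have key : reduced j c t i v ≤ reduced j c t i w + 1 := by
      unfold reduced
      rcases h.reduction_step c hw hwv hc with ⟨hno, h1⟩ | ⟨l, h1, h2⟩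
      · have : ¬ w + 2 ≤ v := fun h2 => by
          obtain ⟨l, hl, hlv⟩ := hall w v ⟨hw, hv, h2, hc⟩ le_rfl
          exact hno l hl hlv
        lia
      · have := hcd l
        lia
    rcases hm.lt_or_eq with hlt | rfl
    · exact ih (fun s' t' hg hle => hall s' t' hg (hle.trans hwv.le)) m (by lia)
    · exact ⟨v, hv, rfl⟩

/-- With weights `d l - 1` each step between consecutive entries contributes exactly 1: a gap
contributes `d l - (d l - 1)`, and any other step already has length 1. -/
theorem reduced_eq_ncard (h : IsGapFamily R j d t) {i : Fin n}
    (hall : ∀ s' t', IsGap (R i) s' t' → ∃ l, j l = i ∧ t l = t') :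
    ∀ v ∈ R i, reduced j (fun l => d l - 1) t i v = {m | m ∈ R i ∧ m < v}.ncard := by
  refine row_induction ?_ ?_ (h.zero_mem i)
  · simp [h.reduced_zero]
  · intro w hw v hv hwv hc ih
    have hset : {m | m ∈ R i ∧ m < v} = insert w {m | m ∈ R i ∧ m < w} := by
      ext m
      constructor
      · rintro ⟨hm, hmv⟩
        rcases ((hc m hm).resolve_right (by lia)).lt_or_eq with h1 | rfl
        · exact .inr ⟨hm, h1⟩
        · exact .inl rfl
      · rintro (rfl | ⟨hm, hmw⟩)
        · exact ⟨hw, hwv⟩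
        · exact ⟨hm, hmw.trans hwv⟩
    rw [hset, Set.ncard_insert_of_notMem (fun hm => lt_irrefl _ hm.2)
      ((Set.finite_Iio w).subset fun m hm => hm.2), ← ih]
    have hle := h.reduction_le (c := fun l => d l - 1) (fun l => Nat.sub_le _ _) hw
    unfold reduced
    rcases h.reduction_step (fun l => d l - 1) hw hwv hc with ⟨hno, h1⟩ | ⟨l, h1, h2⟩
    · have : ¬ w + 2 ≤ v := fun h2 => by
        obtain ⟨l, hl, hlv⟩ := hall w v ⟨hw, hv, h2, hc⟩
        exact hno l hl hlv
      lia
    · have := h.two_le l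
      lia

/-- A lowest gap `(s, t')` of row `i` which is not in the family. -/
structure IsNext (R : Fin n → Set ℕ) (j : Fin r → Fin n) (t : Fin r → ℕ) (i : Fin n)
    (s t' : ℕ) : Prop where
  gap : IsGap (R i) s t'
  ne : ∀ l, j l = i → t l ≠ t'
  exists_of_lt : ∀ s'' t'', IsGap (R i) s'' t'' → t'' < t' → ∃ l, j l = i ∧ t l = t''

variable {i : Fin n} {s t' : ℕ}

theorem reduced_next (h : IsGapFamily R j d t) {c : Fin r → ℕ} (hcd : ∀ l, c l ≤ d l)
    (hn : IsNext R j t i s t') :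
    reduced j c t i t' = reduced j c t i s + (t' - s) := by
  have h2 := hn.gap.2.2.1
  have h1 := h.reduction_eq_of_forall_ne c (by lia) hn.gap.2.2.2 hn.ne
  have h3 := h.reduction_le hcd hn.gap.1
  unfold reduced
  lia

/-- Translates the test `≤ p` in the current ideal into a comparison with the threshold `t'` in the
original row. -/
theorem reduced_le_iff_lt (h : IsGapFamily R j d t) {c : Fin r → ℕ} (hcd : ∀ l, c l ≤ d l)
    (hn : IsNext R j t i s t') {v : ℕ} (hv : v ∈ R i) :
    reduced j c t i v ≤ reduced j c t i s ↔ v < t' := by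
  have h1 := h.reduced_next hcd hn
  have h2 := hn.gap.2.2.1
  constructor
  · intro hle
    by_contra! hcon
    have := h.reduced_mono hcd hn.gap.2.1 hv hcon
    lia
  · intro hlt
    exact h.reduced_mono hcd hv hn.gap.1 ((hn.gap.2.2.2 v hv).resolve_right (by lia))

/-- The bounds `c l ≤ d l ≤ c l + 1` cover both the polarization (`c = d`) and the shift (`c = d -
1`). The next gap keeps its width `t' - s` in both, although its lower end may differ. -/
theorem hasGap_of_row_eq (h : IsGapFamily R j d t) {c : Fin r → ℕ} (hcd : ∀ l, c l ≤ d l)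
    (hdc : ∀ l, d l ≤ c l + 1) (hn : IsNext R j t i s t') {σ : Type*}
    {J : Ideal (MvPolynomial σ K)} {x : σ} (hJ : row J x = reduced j c t i '' R i) :
    HasGap J x (reduced j c t i s) (t' - s) := by
  have h1 := h.reduced_next hcd hn
  have h2 := hn.gap.2.2.1
  rw [HasGap, hJ]
  refine ⟨by lia, fun m hm => ?_, ⟨t', hn.gap.2.1, h1⟩, ?_⟩
  · refine h.exists_reduced_eq hdc s hn.gap.1 (fun s'' t'' hg hle => ?_) m hm
    exact hn.exists_of_lt s'' t'' hg (by lia)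
  · rintro _ ⟨v, hv, rfl⟩
    rw [← h1, h.reduced_le_iff_lt hcd hn hv]
    rcases lt_or_ge v t' with hlt | hle
    · exact .inl hlt
    · exact .inr (h.reduced_mono hcd hn.gap.2.1 hv hle)

theorem snoc (h : IsGapFamily R j d t) (hn : IsNext R j t i s t') :
    IsGapFamily R (Fin.snoc (α := fun _ => Fin n) j i) (Fin.snoc (α := fun _ => ℕ) d (t' - s))
      (Fin.snoc (α := fun _ => ℕ) t t') where
  zero_mem := h.zero_mem
  gap := by
    rw [Fin.forall_fin_succ']
    refine ⟨fun l => by simpa using h.gap l, ?_⟩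
    have := hn.gap.2.2.1
    exact ⟨s, by simpa using hn.gap, by simp; lia⟩
  inj := by
    simp only [Fin.forall_fin_succ', Fin.snoc_castSucc, Fin.snoc_last]
    refine ⟨fun l => ⟨fun l' h1 h2 => congrArg _ (h.inj l l' h1 h2), fun h1 h2 => ?_⟩,
      fun l h1 h2 => ?_, by simp⟩
    · exact absurd h2 (hn.ne l h1)
    · exact absurd h2.symm (hn.ne l h1.symm)
  closed := by
    have hold : ∀ i' t'', (∃ l, j l = i' ∧ t l = t'') →
        ∃ l, Fin.snoc (α := fun _ => Fin n) j i l = i' ∧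
          Fin.snoc (α := fun _ => ℕ) t t' l = t'' := by
      rintro i' t'' ⟨l, h1, h2⟩
      exact ⟨l.castSucc, by simpa using h1, by simpa using h2⟩
    rw [Fin.forall_fin_succ']
    simp only [Fin.snoc_castSucc, Fin.snoc_last]
    refine ⟨fun l s'' t'' hg hle => hold _ _ (h.closed l s'' t'' hg hle), fun s'' t'' hg hle => ?_⟩
    rcases hle.lt_or_eq with hlt | rfl
    · exact hold _ _ (hn.exists_of_lt s'' t'' hg hlt)
    · exact ⟨Fin.last r, by simp⟩

end IsGapFamily

theorem reduction_snoc (j : Fin r → Fin n) (c t : Fin r → ℕ) (i i' : Fin n) (w t' m : ℕ) :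
    reduction (Fin.snoc (α := fun _ => Fin n) j i) (Fin.snoc (α := fun _ => ℕ) c w)
      (Fin.snoc (α := fun _ => ℕ) t t') i' m =
      reduction j c t i' m + if i = i' ∧ t' ≤ m then w else 0 := by
  simp [reduction, Fin.sum_univ_castSucc]

end Row

/-! ### Construction of a full weighted polarization. -/

section Construction

variable {n r : ℕ}

/-- The exponents of the weighted polarization at the thresholds `t`. -/
def polarizedExp (j : Fin r → Fin n) (d t : Fin r → ℕ) (a : Fin n →₀ ℕ) : Fin n ⊕ Fin r →₀ ℕ :=
  Finsupp.equivFunOnFinite.symm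
    (Sum.elim (fun i => reduced j d t i (a i)) fun l => if t l ≤ a (j l) then 1 else 0)

/-- The exponents of the shift at the thresholds `t`. -/
def shiftedExp (j : Fin r → Fin n) (d t : Fin r → ℕ) (a : Fin n →₀ ℕ) : Fin n →₀ ℕ :=
  Finsupp.equivFunOnFinite.symm fun i => reduced j (fun l => d l - 1) t i (a i)

@[simp]
theorem polarizedExp_inl (j : Fin r → Fin n) (d t : Fin r → ℕ) (a : Fin n →₀ ℕ) (i : Fin n) :
    polarizedExp j d t a (Sum.inl i) = reduced j d t i (a i) := rfl

@[simp]
theorem polarizedExp_inr (j : Fin r → Fin n) (d t : Fin r → ℕ) (a : Fin n →₀ ℕ) (l : Fin r) :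
    polarizedExp j d t a (Sum.inr l) = if t l ≤ a (j l) then 1 else 0 := rfl

@[simp]
theorem shiftedExp_apply (j : Fin r → Fin n) (d t : Fin r → ℕ) (a : Fin n →₀ ℕ) (i : Fin n) :
    shiftedExp j d t a i = reduced j (fun l => d l - 1) t i (a i) := rfl

theorem mem_row {σ : Type*} {I : Ideal (MvPolynomial σ K)} {a : σ →₀ ℕ} (ha : a ∈ gens I)
    (i : σ) : a i ∈ row I i := ⟨a, ha, rfl⟩

theorem expSubst_fullVec_polarizedExp (j : Fin r → Fin n) (d t e : Fin r → ℕ) (a : Fin n →₀ ℕ)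
    (i : Fin n) :
    expSubst (fullVec j e) (polarizedExp j d t a) i =
      reduced j d t i (a i) + reduction j e t i (a i) := by
  rw [expSubst_fullVec, polarizedExp_inl, reduction]
  congr 1
  refine Finset.sum_congr rfl fun l _ => ?_
  rw [polarizedExp_inr]
  by_cases h : j l = i
  · subst h
    simp
  · simp [h]

namespace IsGapFamily

variable {I : Ideal (MvPolynomial (Fin n) K)} {j : Fin r → Fin n} {d t : Fin r → ℕ}

theorem expSubst_width_polarizedExp (h : IsGapFamily (row I) j d t) {a : Fin n →₀ ℕ}
    (ha : a ∈ gens I) : expSubst (fullVec j d) (polarizedExp j d t a) = a := by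
  ext i
  rw [expSubst_fullVec_polarizedExp]
  exact Nat.sub_add_cancel (h.reduction_le (fun _ => le_rfl) (mem_row ha i))

theorem expSubst_one_polarizedExp (h : IsGapFamily (row I) j d t) {a : Fin n →₀ ℕ}
    (ha : a ∈ gens I) :
    expSubst (fullVec j fun _ => 1) (polarizedExp j d t a) = shiftedExp j d t a := by
  ext i
  -- Each width splits as `d l = (d l - 1) + 1`: the part removed by the shift and the unit restored
  -- by `z_l = x_{j l}`.
  have h1 : reduction j d t i (a i) =
      reduction j (fun l => d l - 1) t i (a i) + reduction j (fun _ => 1) t i (a i) := by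
    rw [reduction, reduction, reduction, ← Finset.sum_add_distrib]
    refine Finset.sum_congr rfl fun l _ => ?_
    have := h.two_le l
    split_ifs <;> lia
  have h2 := h.reduction_le (fun _ => le_rfl) (mem_row ha i)
  rw [expSubst_fullVec_polarizedExp, shiftedExp_apply]
  unfold reduced
  lia

/-- The exponents of the `z_l` show that every threshold passed by `a i` is passed by `b i`. If `b i
< a i`, the two reductions therefore agree, and comparing the reduced exponents gives a
contradiction. -/
theorem le_of_polarizedExp_le (h : IsGapFamily (row I) j d t) :
    ∀ a ∈ gens I, ∀ b ∈ gens I, polarizedExp j d t a ≤ polarizedExp j d t b → a ≤ b := by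
  intro a ha b hb hab i
  by_contra! hlt
  have h1 : reduced j d t i (a i) ≤ reduced j d t i (b i) := hab (Sum.inl i)
  have h2 : reduction j d t i (a i) = reduction j d t i (b i) := by
    refine Finset.sum_congr rfl fun l _ => if_congr (and_congr_right fun hl => ?_) rfl rfl
    have h3 := hab (Sum.inr l)
    rw [polarizedExp_inr, polarizedExp_inr, hl] at h3
    split_ifs at h3 <;> lia
  have h3 := h.reduction_le (fun _ => le_rfl) (mem_row ha i)
  have h4 := h.reduction_le (fun _ => le_rfl) (mem_row hb i)
  unfold reduced at h1
  lia

theorem le_of_shiftedExp_le (h : IsGapFamily (row I) j d t) :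
    ∀ a ∈ gens I, ∀ b ∈ gens I, shiftedExp j d t a ≤ shiftedExp j d t b → a ≤ b := by
  intro a ha b hb hab i
  by_contra! hlt
  refine (hab i).not_gt (h.reduced_strictMono (fun l => ?_) (mem_row hb i) (mem_row ha i) hlt)
  have := h.two_le l
  lia

theorem row_polarized (h : IsGapFamily (row I) j d t) (i : Fin n) :
    row (mapGens I (polarizedExp j d t)) (Sum.inl i) = reduced j d t i '' row I i := by
  rw [row, gens_mapGens h.le_of_polarizedExp_le]
  ext m
  simp [row]

theorem row_shifted (h : IsGapFamily (row I) j d t) (i : Fin n) :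
    row (mapGens I (shiftedExp j d t)) i =
      reduced j (fun l => d l - 1) t i '' row I i := by
  rw [row, gens_mapGens h.le_of_shiftedExp_le]
  ext m
  simp [row]

variable {i : Fin n} {s t' : ℕ}

theorem shift_next (h : IsGapFamily (row I) j d t) (hn : IsNext (row I) j t i s t') :
    shift (mapGens I (shiftedExp j d t)) i (reduced j (fun l => d l - 1) t i s) (t' - s) =
      mapGens I (shiftedExp (Fin.snoc (α := fun _ => Fin n) j i)
        (Fin.snoc (α := fun _ => ℕ) d (t' - s)) (Fin.snoc (α := fun _ => ℕ) t t')) := by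
  rw [shift, mapGens_mapGens h.le_of_shiftedExp_le]
  refine mapGens_congr fun a ha => ?_
  have hsnoc : (fun l => Fin.snoc (α := fun _ => ℕ) d (t' - s) l - 1) =
      Fin.snoc (α := fun _ => ℕ) (fun l => d l - 1) (t' - s - 1) := by
    funext l
    induction l using Fin.lastCases <;> simp
  have hlt := h.reduced_le_iff_lt (c := fun l => d l - 1) (fun l => Nat.sub_le _ _) hn
    (mem_row ha i)
  ext i'
  rw [shiftedExp_apply, hsnoc, Function.comp_apply, shiftExp, shiftedExp_apply,
    if_congr hlt rfl rfl]
  unfold reduced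
  rw [reduction_snoc]
  split_ifs with h1 h2 h2
  · lia
  · simp [reduced]
  · obtain ⟨rfl, h2⟩ := h2
    simp [reduced, Nat.sub_sub]
  · have : i ≠ i' := by
      rintro rfl
      exact h2 ⟨rfl, by lia⟩
    simp [reduced, this]

theorem partialPol_next (h : IsGapFamily (row I) j d t) (hn : IsNext (row I) j t i s t') :
    partialPol (Sum.map id Fin.castSucc) (Sum.inr (Fin.last r)) (mapGens I (polarizedExp j d t))
        (Sum.inl i) (reduced j d t i s) (t' - s) =
      mapGens I (polarizedExp (Fin.snoc (α := fun _ => Fin n) j i)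
        (Fin.snoc (α := fun _ => ℕ) d (t' - s)) (Fin.snoc (α := fun _ => ℕ) t t')) := by
  rw [partialPol, mapGens_mapGens h.le_of_polarizedExp_le]
  refine mapGens_congr fun a ha => ?_
  have hlt := h.reduced_le_iff_lt (c := d) (fun l => le_rfl) hn (mem_row ha i)
  have hinj : Function.Injective (Sum.map (id : Fin n → Fin n) (Fin.castSucc (n := r))) :=
    Sum.map_injective.2 ⟨Function.injective_id, Fin.castSucc_injective r⟩
  have hinl : ∀ (b : Fin n ⊕ Fin r →₀ ℕ) (i' : Fin n),
      b.mapDomain (Sum.map id Fin.castSucc) (Sum.inl i' : Fin n ⊕ Fin (r + 1)) = b (Sum.inl i') :=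
    fun b i' => Finsupp.mapDomain_apply hinj b (Sum.inl i')
  have hinr : ∀ (b : Fin n ⊕ Fin r →₀ ℕ) (l : Fin r),
      b.mapDomain (Sum.map id Fin.castSucc) (Sum.inr l.castSucc : Fin n ⊕ Fin (r + 1)) =
        b (Sum.inr l) :=
    fun b l => Finsupp.mapDomain_apply hinj b (Sum.inr l)
  have hlast : ∀ b : Fin n ⊕ Fin r →₀ ℕ,
      b.mapDomain (Sum.map id Fin.castSucc) (Sum.inr (Fin.last r) : Fin n ⊕ Fin (r + 1)) = 0 :=
    fun b => Finsupp.mapDomain_of_notMem_range _ _ (by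
      rintro ⟨x | l, hx⟩
      · simp at hx
      · exact Fin.castSucc_ne_last l (Sum.inr_injective hx))
  rw [Function.comp_apply, polExp, polarizedExp_inl, if_congr hlt rfl rfl]
  ext x
  rcases x with i' | l
  · rw [polarizedExp_inl]
    unfold reduced
    rw [reduction_snoc]
    split_ifs with h1 h2 h2
    · lia
    · simp [hinl, reduced]
    · obtain ⟨rfl, h2⟩ := h2
      simp [hinl, reduced, Nat.sub_sub]
    · have : i ≠ i' := by
        rintro rfl
        exact h2 ⟨rfl, by lia⟩
      simp [hinl, reduced, this]
  · induction l using Fin.lastCases with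
    | last =>
      rw [polarizedExp_inr, Fin.snoc_last, Fin.snoc_last]
      split_ifs
      · lia
      · exact hlast _
      · simp [hlast]
      · lia
    | cast l =>
      rw [polarizedExp_inr, Fin.snoc_castSucc, Fin.snoc_castSucc]
      split_ifs <;> simp [*]

theorem weightedPolarization_next (h : IsGapFamily (row I) j d t)
    (hn : IsNext (row I) j t i s t')
    (hW : WeightedPolarization I r j d (mapGens I (polarizedExp j d t))
      (mapGens I (shiftedExp j d t))) :
    WeightedPolarization I (r + 1) (Fin.snoc (α := fun _ => Fin n) j i)
      (Fin.snoc (α := fun _ => ℕ) d (t' - s))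
      (mapGens I (polarizedExp (Fin.snoc (α := fun _ => Fin n) j i)
        (Fin.snoc (α := fun _ => ℕ) d (t' - s)) (Fin.snoc (α := fun _ => ℕ) t t')))
      (mapGens I (shiftedExp (Fin.snoc (α := fun _ => Fin n) j i)
        (Fin.snoc (α := fun _ => ℕ) d (t' - s)) (Fin.snoc (α := fun _ => ℕ) t t'))) := by
  rw [← h.partialPol_next hn, ← h.shift_next hn]
  refine .step i _ _ _ hW ?_ ?_
  · exact h.hasGap_of_row_eq (fun _ => le_rfl) (fun _ => Nat.le_succ _) hn (h.row_polarized i)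
  · exact h.hasGap_of_row_eq (fun _ => Nat.sub_le _ _) (fun l => by lia) hn (h.row_shifted i)

theorem exists_isNext {i : Fin n}
    (hex : ∃ s t', IsGap (row I i) s t' ∧ ∀ l, j l = i → t l ≠ t') :
    ∃ s t', IsNext (row I) j t i s t' := by
  classical
  obtain ⟨s, t', hst⟩ := hex
  have hex' : ∃ t', ∃ s, IsGap (row I i) s t' ∧ ∀ l, j l = i → t l ≠ t' := ⟨t', s, hst⟩
  obtain ⟨s, hs1, hs2⟩ := Nat.find_spec hex'
  refine ⟨s, Nat.find hex', hs1, hs2, fun s'' t'' hg hlt => ?_⟩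
  have := Nat.find_min hex' hlt
  push Not at this
  exact this s'' hg

/-- Distinct gaps have distinct upper ends within a row; this bounds the number of polarizations. -/
theorem le_card (h : IsGapFamily (row I) j d t) :
    r ≤ Nat.card (Σ i, row I i) := by
  have : ∀ i, Finite (row I i) := fun i => finite_row I i
  have hinj : Function.Injective fun l : Fin r => (⟨j l, t l, h.t_mem l⟩ : Σ i, row I i) := by
    intro l l' hll
    have h1 : j l = j l' := congrArg Sigma.fst hll
    have h2 : t l = t l' := congrArg (fun x : Σ i, row I i => (x.2 : ℕ)) hll
    exact h.inj l l' h1 h2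
  simpa using Nat.card_le_card_of_injective _ hinj

end IsGapFamily

/-- Lowest missing gaps are added one by one; `m` bounds how many can still be added. -/
theorem exists_complete_of_isGapFamily {I : Ideal (MvPolynomial (Fin n) K)} (m : ℕ) :
    ∀ {r : ℕ} {j : Fin r → Fin n} {d t : Fin r → ℕ}, IsGapFamily (row I) j d t →
      WeightedPolarization I r j d (mapGens I (polarizedExp j d t))
        (mapGens I (shiftedExp j d t)) →
      Nat.card (Σ i, row I i) ≤ r + m →
      ∃ (r : ℕ) (j : Fin r → Fin n) (d t : Fin r → ℕ), IsGapFamily (row I) j d t ∧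
        WeightedPolarization I r j d (mapGens I (polarizedExp j d t))
          (mapGens I (shiftedExp j d t)) ∧
        ∀ i s t', IsGap (row I i) s t' → ∃ l, j l = i ∧ t l = t' := by
  induction m with
  | zero =>
    intro r j d t h hW hm
    refine ⟨r, j, d, t, h, hW, ?_⟩
    by_contra! hcon
    obtain ⟨i, s, t', hg, hne⟩ := hcon
    obtain ⟨s, t', hn⟩ := IsGapFamily.exists_isNext ⟨s, t', hg, hne⟩
    have := (h.snoc hn).le_card
    lia
  | succ m ih =>
    intro r j d t h hW hm
    by_cases hcon : ∀ i s t', IsGap (row I i) s t' → ∃ l, j l = i ∧ t l = t'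
    · exact ⟨r, j, d, t, h, hW, hcon⟩
    · push Not at hcon
      obtain ⟨i, s, t', hg, hne⟩ := hcon
      obtain ⟨s, t', hn⟩ := IsGapFamily.exists_isNext ⟨s, t', hg, hne⟩
      exact ih (h.snoc hn) (h.weightedPolarization_next hn hW) (by lia)

theorem exists_complete_weightedPolarization {I : Ideal (MvPolynomial (Fin n) K)}
    (hI : IsMonomialIdeal I) (h0 : ∀ i, 0 ∈ row I i) :
    ∃ (r : ℕ) (j : Fin r → Fin n) (d t : Fin r → ℕ), IsGapFamily (row I) j d t ∧
      WeightedPolarization I r j d (mapGens I (polarizedExp j d t))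
        (mapGens I (shiftedExp j d t)) ∧
      ∀ i s t', IsGap (row I i) s t' → ∃ l, j l = i ∧ t l = t' := by
  let j : Fin 0 → Fin n := Fin.elim0
  let d : Fin 0 → ℕ := Fin.elim0
  have hP : mapGens I (polarizedExp j d d) = I.map (rename (R := K) Sum.inl) := by
    conv_rhs => rw [hI.eq_monomialSpan_gens, Ideal.map_span, Set.image_image]
    rw [mapGens]
    congr 1
    refine Set.image_congr fun a _ => ?_
    rw [rename_monomial]
    congr 2
    ext x
    rcases x with i | l
    · rw [Finsupp.mapDomain_apply Sum.inl_injective]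
      simp [reduced, reduction]
    · exact l.elim0
  have hL : mapGens I (shiftedExp j d d) = I := by
    conv_rhs => rw [hI.eq_monomialSpan_gens]
    rw [mapGens]
    congr 1
    refine Set.image_congr fun a _ => ?_
    congr 2
    ext i
    simp [reduced, reduction]
  refine exists_complete_of_isGapFamily (Nat.card (Σ i, row I i)) (j := j) (d := d) (t := d)
    ⟨h0, fun l => l.elim0, fun l => l.elim0, fun l => l.elim0⟩ ?_ (Nat.le_add_left _ _)
  rw [hP, hL]
  exact .refl j d

theorem IsGapFamily.shifted_eq_sgn {I : Ideal (MvPolynomial (Fin n) K)} {j : Fin r → Fin n}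
    {d t : Fin r → ℕ} (h : IsGapFamily (row I) j d t)
    (hall : ∀ i s t', IsGap (row I i) s t' → ∃ l, j l = i ∧ t l = t') :
    mapGens I (shiftedExp j d t) = sgn I := by
  refine mapGens_congr fun a ha => ?_
  ext i
  exact h.reduced_eq_ncard (hall i) _ (mem_row ha i)

/-- If `z_k` divides the generator from `b` but not the one from `a`, then `a (j k) < t k ≤ b (j
k)`. The reduced exponent and the exponents of all `z_l` with `j l = j k` are monotone in the
original exponent, so the criterion holds whatever the weights `e` are. -/
theorem IsGapFamily.isWeaklyRegular {I : Ideal (MvPolynomial (Fin n) K)} {j : Fin r → Fin n}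
    {d t : Fin r → ℕ} (h : IsGapFamily (row I) j d t) (e : Fin r → ℕ) :
    RingTheory.Sequence.IsWeaklyRegular
      (MvPolynomial (Fin n ⊕ Fin r) K ⧸ monomialSpan K (polarizedExp j d t '' gens I))
      (List.ofFn (substElem K j e)) := by
  refine isWeaklyRegular_ofFn_substElem j e ?_ ?_
  · rintro _ ⟨a, ha, rfl⟩ l
    rw [polarizedExp_inr]
    split_ifs <;> simp
  · rintro k _ ⟨a, ha, rfl⟩ _ ⟨b, hb, rfl⟩ hak hbk
    have hlt : a (j k) < b (j k) := by
      rw [polarizedExp_inr] at hak hbk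
      split_ifs at hak hbk <;> lia
    rw [expSubst_partialVec_inl, expSubst_partialVec_inl]
    refine add_le_add (h.reduced_mono (fun _ => le_rfl) (mem_row ha _) (mem_row hb _) hlt.le)
      (Finset.sum_le_sum fun l _ => ?_)
    split_ifs with hl
    · rw [polarizedExp_inr, polarizedExp_inr, hl.2]
      refine Nat.mul_le_mul_right _ ?_
      split_ifs <;> lia
    · exact le_rfl

/-! ### Heights and dimensions of the signature and the polarization. -/

theorem notMem_gens_zero {σ : Type*} {I : Ideal (MvPolynomial σ K)} (hI : I ≠ ⊤) :
    0 ∉ gens I :=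
  fun h => hI ((Ideal.eq_top_iff_one I).2 h.1)

/-- Otherwise `x_i` divides every generator, and the cover `{i}` bounds the height by 1. -/
theorem zero_mem_row_of_two_le_height {I : Ideal (MvPolynomial (Fin n) K)}
    (hI : IsMonomialIdeal I) (hht : 2 ≤ I.height) (i : Fin n) : 0 ∈ row I i := by
  by_contra hcon
  have hcov : IsCover (gens I) {i} := fun a ha =>
    ⟨i, by simp, fun h0 => hcon (h0 ▸ mem_row ha i)⟩
  have h1 := hcov.height_le (K := K)
  rw [← hI.eq_monomialSpan_gens] at h1
  have h2 := hht.trans h1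
  norm_num at h2

theorem height_eq_and_ringKrullDim_eq_add {σ τ : Type*} [Finite σ] [Finite τ]
    {A : Set (σ →₀ ℕ)} {B : Set (τ →₀ ℕ)} (hA : 0 ∉ A) (hB : 0 ∉ B)
    (hAB : ∀ C, IsCover A C → ∃ C', IsCover B C' ∧ C'.card ≤ C.card)
    (hBA : ∀ C, IsCover B C → ∃ C', IsCover A C' ∧ C'.card ≤ C.card) {r : ℕ}
    (hr : Nat.card τ = Nat.card σ + r) :
    (monomialSpan K B).height = (monomialSpan K A).height ∧
      ringKrullDim (MvPolynomial τ K ⧸ monomialSpan K B) =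
        ringKrullDim (MvPolynomial σ K ⧸ monomialSpan K A) + r := by
  obtain ⟨C, hC, hCmin, hCht, hCdim⟩ := exists_isCover_height_eq (K := K) hA
  obtain ⟨D, hD, hDmin, hDht, hDdim⟩ := exists_isCover_height_eq (K := K) hB
  have hcard : C.card = D.card := by
    obtain ⟨C', hC', hle⟩ := hAB C hC
    obtain ⟨D', hD', hle'⟩ := hBA D hD
    exact ((hCmin D' hD').trans hle').antisymm ((hDmin C' hC').trans hle)
  refine ⟨by rw [hCht, hDht, hcard], ?_⟩
  -- Both dimensions are finite, so the comparison can be made in `ℕ`.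
  have key : ∀ {x : WithBot ℕ∞} {c N : ℕ}, x + c = N → ∃ k : ℕ, x = k ∧ k + c = N := by
    intro x c N hx
    induction x with
    | bot => simp at hx
    | coe x =>
      induction x using ENat.recTopCoe with
      | top =>
        have h1 : (⊤ : ℕ∞) + c = N := WithBot.coe_injective hx
        rw [top_add] at h1
        exact absurd h1.symm (ENat.natCast_ne_top N)
      | coe k => exact ⟨k, rfl, by exact_mod_cast hx⟩
  obtain ⟨k, hk, hk'⟩ := key hCdim
  obtain ⟨m, hm, hm'⟩ := key hDdim
  rw [hk, hm]
  exact_mod_cast (by lia : m = k + r)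

theorem sgnExp_apply_ne_zero_iff {I : Ideal (MvPolynomial (Fin n) K)} {i : Fin n}
    (h0 : 0 ∈ row I i) (a : Fin n →₀ ℕ) : sgnExp I a i ≠ 0 ↔ a i ≠ 0 := by
  change {m | m ∈ row I i ∧ m < a i}.ncard ≠ 0 ↔ _
  rw [← Nat.pos_iff_ne_zero, Set.ncard_pos ((Set.finite_Iio (a i)).subset fun m hm => hm.2)]
  exact ⟨fun ⟨m, hm⟩ => (Nat.zero_le m).trans_lt hm.2 |>.ne', fun h => ⟨0, h0, Nat.pos_of_ne_zero h⟩⟩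

/-- As 0 occurs in every row, exactly the zero entries have position 0; supports and covers are
unchanged. -/
theorem height_sgn_eq {I : Ideal (MvPolynomial (Fin n) K)} (hI : IsMonomialIdeal I)
    (hI_ne : I ≠ ⊤) (h0 : ∀ i, 0 ∈ row I i) : (sgn I).height = I.height := by
  have hcov : ∀ C, IsCover (gens I) C ↔ IsCover (sgnExp I '' gens I) C := fun C => by
    simp only [IsCover, Set.forall_mem_image, sgnExp_apply_ne_zero_iff (h0 _)]
  have h0' : (0 : Fin n →₀ ℕ) ∉ sgnExp I '' gens I := by
    rintro ⟨a, ha, ha0⟩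
    refine notMem_gens_zero hI_ne ?_
    rwa [show (0 : Fin n →₀ ℕ) = a from ?_]
    ext i
    by_contra hne
    exact (sgnExp_apply_ne_zero_iff (h0 i) a).2 (Ne.symm hne) (DFunLike.congr_fun ha0 i)
  have := (height_eq_and_ringKrullDim_eq_add (K := K) (notMem_gens_zero hI_ne) h0'
    (fun C hC => ⟨C, (hcov C).1 hC, le_rfl⟩) (fun C hC => ⟨C, (hcov C).2 hC, le_rfl⟩)
    (add_zero _).symm).1
  rwa [← hI.eq_monomialSpan_gens, ← mapGens_eq_monomialSpan] at this

namespace IsGapFamily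

variable {I : Ideal (MvPolynomial (Fin n) K)} {j : Fin r → Fin n} {d t : Fin r → ℕ}

theorem zero_notMem_polarized (h : IsGapFamily (row I) j d t) (hI_ne : I ≠ ⊤) :
    (0 : Fin n ⊕ Fin r →₀ ℕ) ∉ polarizedExp j d t '' gens I := by
  rintro ⟨a, ha, ha0⟩
  refine notMem_gens_zero hI_ne ?_
  have := h.expSubst_width_polarizedExp ha
  rw [ha0, expSubst, Finsupp.sum_zero_index] at this
  rwa [← this] at ha

/-- For every variable `x i` there is a variable of the polarization which divides all generators
that come from generators divisible by `x i`. -/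
theorem exists_polarizedExp_ne_zero (h : IsGapFamily (row I) j d t)
    (hall : ∀ i s t', IsGap (row I i) s t' → ∃ l, j l = i ∧ t l = t') (i : Fin n) :
    ∃ x : Fin n ⊕ Fin r, ∀ a ∈ gens I, a i ≠ 0 → polarizedExp j d t a x ≠ 0 := by
  classical
  by_cases hex : ∃ m, m ∈ row I i ∧ 0 < m
  · obtain ⟨hm, hpos⟩ := Nat.find_spec hex
    set m := Nat.find hex with hmdef
    have hmin : ∀ v ∈ row I i, v ≤ 0 ∨ m ≤ v := fun v hv => by
      rcases Nat.eq_zero_or_pos v with rfl | hv0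
      · exact .inl le_rfl
      · exact .inr (Nat.find_min' hex ⟨hv, hv0⟩)
    have hle : ∀ a ∈ gens I, a i ≠ 0 → m ≤ a i := fun a ha hne =>
      (hmin _ (mem_row ha i)).resolve_left (by lia)
    -- Here `m` is the least positive entry. If `m ≥ 2`, the row has the gap from 0 to `m`, and its
    -- `z_l` divides all the generators in question. If `m = 1`, no threshold is at most 1, so `x_i`
    -- itself survives.
    by_cases hm2 : 2 ≤ m
    · obtain ⟨l, rfl, hl⟩ := hall i 0 m ⟨h.zero_mem i, hm, by lia, hmin⟩
      refine ⟨Sum.inr l, fun a ha hne => ?_⟩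
      rw [polarizedExp_inr, hl, if_pos (hle a ha hne)]
      exact one_ne_zero
    · refine ⟨Sum.inl i, fun a ha hne => ?_⟩
      have h1 := h.reduced_mono (fun _ => le_rfl) hm (mem_row ha i) (hle a ha hne)
      have h2 : reduction j d t i m = 0 := by
        refine Finset.sum_eq_zero fun l _ => if_neg fun hl => ?_
        obtain ⟨s, hs, -⟩ := h.gap l
        have := hs.2.2.1
        lia
      rw [polarizedExp_inl]
      unfold reduced at h1 ⊢
      lia
  · push Not at hex
    exact ⟨Sum.inl i, fun a ha hne => absurd (Nat.le_zero.1 (hex _ (mem_row ha i))) hne⟩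

theorem height_and_ringKrullDim_polarized (h : IsGapFamily (row I) j d t) (hI : IsMonomialIdeal I)
    (hI_ne : I ≠ ⊤) (hall : ∀ i s t', IsGap (row I i) s t' → ∃ l, j l = i ∧ t l = t') :
    (mapGens I (polarizedExp j d t)).height = I.height ∧
      ringKrullDim (MvPolynomial (Fin n ⊕ Fin r) K ⧸ mapGens I (polarizedExp j d t)) =
        ringKrullDim (MvPolynomial (Fin n) K ⧸ I) + r := by
  classical
  choose ρ hρ using h.exists_polarizedExp_ne_zero hall
  have := height_eq_and_ringKrullDim_eq_add (K := K) (notMem_gens_zero hI_ne)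
    (h.zero_notMem_polarized hI_ne) (r := r) (fun C hC => ?_) (fun C hC => ?_) (by simp)
  · rwa [← mapGens_eq_monomialSpan, ← hI.eq_monomialSpan_gens] at this
  · refine ⟨C.image ρ, ?_, Finset.card_image_le⟩
    rintro _ ⟨a, ha, rfl⟩
    obtain ⟨i, hi, hai⟩ := hC a ha
    exact ⟨ρ i, Finset.mem_image_of_mem ρ hi, hρ i a ha hai⟩
  -- Conversely, each `z_l` in a cover is replaced by `x_{j l}`: thresholds are positive, so `z_l`
  -- occurs only for generators divisible by `x_{j l}`.
  · refine ⟨C.image (Sum.elim id j), fun a ha => ?_, Finset.card_image_le⟩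
    obtain ⟨x, hx, hax⟩ := hC _ ⟨a, ha, rfl⟩
    refine ⟨Sum.elim id j x, Finset.mem_image_of_mem _ hx, fun h0 => hax ?_⟩
    rcases x with i | l
    · rw [polarizedExp_inl, show a i = 0 from h0, h.reduced_zero]
    · rw [polarizedExp_inr, if_neg]
      rw [show a (j l) = 0 from h0]
      exact (h.t_pos l).not_ge

end IsGapFamily

end Construction

end MonomialSignature

end

theorem mainTheorem5 {K : Type*} [Field K] {n : ℕ} (I : Ideal (MvPolynomial (Fin n) K))
    (hI : MonomialSignature.IsMonomialIdeal I) (hI_ne : I ≠ ⊤) (hht : 2 ≤ I.height) :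
    ∃ (r : ℕ) (j : Fin r → Fin n) (d : Fin r → ℕ)
      (P : Ideal (MvPolynomial (Fin n ⊕ Fin r) K))
      (f g : Fin r → MvPolynomial (Fin n ⊕ Fin r) K),
      MonomialSignature.IsFullWeightedPolarization I r j d P ∧
      (∀ k, 2 ≤ d k) ∧
      (∀ k, f k = X (Sum.inr k) - X (Sum.inl (j k)) ^ d k) ∧
      (∀ k, g k = X (Sum.inr k) - X (Sum.inl (j k))) ∧
      RingTheory.Sequence.IsRegular (MvPolynomial (Fin n ⊕ Fin r) K) (List.ofFn f) ∧
      RingTheory.Sequence.IsRegular (MvPolynomial (Fin n ⊕ Fin r) K) (List.ofFn g) ∧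
      RingTheory.Sequence.IsRegular (MvPolynomial (Fin n ⊕ Fin r) K ⧸ P) (List.ofFn f) ∧
      RingTheory.Sequence.IsRegular (MvPolynomial (Fin n ⊕ Fin r) K ⧸ P) (List.ofFn g) ∧
      MonomialSignature.QuotientEq P f I ∧
      MonomialSignature.QuotientEq P g (MonomialSignature.sgn I) ∧
      P.height = I.height ∧
      (MonomialSignature.sgn I).height = I.height ∧
      ringKrullDim (MvPolynomial (Fin n ⊕ Fin r) K ⧸ P) =
        ringKrullDim (MvPolynomial (Fin n) K ⧸ I) + r ∧
      MonomialSignature.quotDepth P = MonomialSignature.quotDepth I + r := by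
  open MonomialSignature in
  have h0 := zero_mem_row_of_two_le_height hI hht
  obtain ⟨r, j, d, t, h, hW, hall⟩ := exists_complete_weightedPolarization hI h0
  have hsgn := h.shifted_eq_sgn hall
  have hd : ∀ l, d l ≠ 0 := fun l => by
    have := h.two_le l
    lia
  have hA := h.zero_notMem_polarized hI_ne
  have hP := mapGens_eq_monomialSpan (I := I) (φ := polarizedExp j d t)
  have hId : monomialSpan K (expSubst (fullVec j d) '' (polarizedExp j d t '' gens I)) = I := by
    rw [Set.image_image, Set.image_congr fun a ha => h.expSubst_width_polarizedExp ha,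
      Set.image_id']
    exact hI.eq_monomialSpan_gens.symm
  have hI1 : monomialSpan K
      (expSubst (fullVec j fun _ => 1) '' (polarizedExp j d t '' gens I)) = sgn I := by
    rw [Set.image_image, Set.image_congr fun a ha => h.expSubst_one_polarizedExp ha, ← hsgn,
      mapGens_eq_monomialSpan]
  obtain ⟨hheight, hdim⟩ := h.height_and_ringKrullDim_polarized hI hI_ne hall
  refine ⟨r, j, d, mapGens I (polarizedExp j d t), substElem K j d, substElem K j fun _ => 1,
    ?_, h.two_le, fun _ => rfl, fun k => by rw [substElem, pow_one],
    isRegular_mvPolynomial_substElem j d hd,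
    isRegular_mvPolynomial_substElem j _ fun _ => one_ne_zero, ?_, ?_, ?_, ?_, hheight,
    height_sgn_eq hI hI_ne h0, hdim, ?_⟩
  · rw [IsFullWeightedPolarization, ← hsgn]
    exact hW
  · rw [hP]
    exact isRegular_substElem_of_isWeaklyRegular j d hA hd (h.isWeaklyRegular d)
  · rw [hP]
    exact isRegular_substElem_of_isWeaklyRegular j _ hA (fun _ => one_ne_zero)
      (h.isWeaklyRegular _)
  · have := quotientEq_substElem (K := K) j d (polarizedExp j d t '' gens I)
    rwa [hId, ← hP] at this
  · have := quotientEq_substElem (K := K) j (fun _ => 1) (polarizedExp j d t '' gens I)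
    rwa [hI1, ← hP] at this
  · have := quotDepth_eq_add (K := K) j d hA hd (h.isWeaklyRegular d)
    rwa [hId, ← hP] at this
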